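/- Let $n\ge 0$ be an integer. For $M\ge 0$ let $\theta_1,\dots,\theta_M\in[0,\pi]$ have the joint density $$C\,w_{n,M}(\theta),\qquad w_{n,M}(\theta)=\prod_{j=1}^M(1-\cos\theta_j)^n\prod_{1\le j<k\le M}(\cos\theta_j-\cos\theta_k)^2,\qquad C^{-1}=\int_{[0,\pi]^M}w_{n,M}\,d\theta .$$ (These are the eigenangles of the $2M$ unconstrained eigenvalues $e^{\pm i\theta_j}$ of matrices in $SO(n+2M)$ conditioned to have $n$ eigenvalues at $1$.) Let $P_j^{(\alpha,\beta)}$ be the Jacobi polynomials, put $P_j=P_j^{(n-1/2,-1/2)}$ and $h_j=h_j^{(n-1/2,-1/2)}$, where $$h_j^{(\alpha,\beta)}=\frac{2^{\alpha+\beta+1}}{2j+\alpha+\beta+1}\,\frac{\Gamma(j+\alpha+1)\Gamma(j+\beta+1)}{\Gamma(j+1)\Gamma(j+\alpha+\beta+1)}$$ (for $j=0$, $(\alpha+\beta+1)\Gamma(\alpha+\beta+1)$ is read as $\Gamma(\alpha+\beta+2)$), and put $$K_M(\theta,\phi)=\sum_{j=0}^{M-1}h_j^{-1}P_j(\cos\theta)P_j(\cos\phi),\qquad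 \widetilde K_M(\theta,\phi)=2^n\sin^n\tfrac{\theta}{2}\,\sin^n\tfrac{\phi}{2}\,K_M(\theta,\phi).$$ Let $J_\nu$ be the Bessel function of the first kind. Then the following hold. 1. $\int_0^\pi P_i(\cos\theta)P_j(\cos\theta)(1-\cos\theta)^n\,d\theta=\delta_{ij}h_i$ for all $i,j\ge 0$. 2. For all $M,m\ge 0$ the $m$-level density is $\det\big(\widetilde K_M(\theta_j,\theta_k)\big)_{j,k=1}^m=\det\big(K_M(\theta_j,\theta_k)\big)_{j,k=1}^m\prod_{j=1}^m(1-\cos\theta_j)^n$. That is, for every $f:[0,\pi]^m\to\mathbb R$ such that $f\cdot\det(\widetilde K_M(\theta_j,\theta_k))$ is integrable on $[0,\pi]^m$, the integral on the left below converges absolutely and $$C\int_{[0,\pi]^M}\ \sum_{1\le j_1<\dots<j_m\le M}f(\theta_{j_1},\dots,\theta_{j_m})\;w_{n,M}(\theta)\,d\theta=\frac1{m!}\int_{[0,\pi]^m}f(\theta_1,\dots,\theta_m)\det\big(\widetilde K_M(\theta_j,\theta_k)\big)_{j,k=1}^m\,d\theta_1\cdots d\theta_m .$$ 3. For all $M\ge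 0$ and all $\theta,\phi$ with $\cos\theta\ne\cos\phi$, $$K_{M+1}(\theta,\phi)=\frac{2^{1-n}}{2M+n+1}\,\frac{\Gamma(M+2)\Gamma(M+n+1)}{\Gamma(M+n+\frac12)\Gamma(M+\frac12)}\cdot\frac{P_{M+1}(\cos\theta)P_M(\cos\phi)-P_M(\cos\theta)P_{M+1}(\cos\phi)}{\cos\theta-\cos\phi}.$$ 4. For all $\theta,\phi>0$ with $\theta\neq\phi$, $$\lim_{M\to\infty}\frac{\pi}{M}\widetilde K_M\Big(\frac{\pi\theta}{M},\frac{\pi\phi}{M}\Big)=L(\theta,\phi):=(\pi\theta)^{1/2}(\pi\phi)^{1/2}\,\frac{\theta J_{n-3/2}(\pi\theta)J_{n-1/2}(\pi\phi)-\phi J_{n-3/2}(\pi\phi)J_{n-1/2}(\pi\theta)}{\phi^2-\theta^2},$$ and the limit is the same with $\widetilde K_{M+1}$ in place of $\widetilde K_M$. 5. For all $\theta>0$ the scaled $1$-level density is $$\lim_{M\to\infty}\frac{\pi}{M}\widetilde K_M\Big(\frac{\pi\theta}{M},\frac{\pi\theta}{M}\Big)=L(\theta,\theta):=\frac{\pi^2}{2}\,\theta\Big(J_{n-3/2}(\pi\theta)^2+J_{n-1/2}(\pi\theta)^2-\frac{2n-1}{\pi\theta}J_{n-1/2}(\pi\theta)J_{n-3/2}(\pi\theta)\Big),$$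 the limit is the same with $\widetilde K_{M+1}$ in place of $\widetilde K_M$, and $L(\theta,\phi)\to L(\theta,\theta)$ as $\phi\to\theta$. 6. There is a constant $c>0$, depending only on $n$, such that $L(\theta,\theta)/\theta^{2n}\to c$ as $\theta\to0^+$. -/

import Mathlib

open MeasureTheory Filter Topology

noncomputable section

namespace ConditionedSO

/-- The Jacobi polynomial `P_j^{(α,β)}`, as a function on `ℝ`, normalised in the usual way by
`P_j^{(α,β)}(1) = (α+1)_j / j!`:
`P_j^{(α,β)}(x) = ∑_{v ≤ j} (α+v+1)_{j-v} (j+α+β+1)_v / (v! (j-v)!) * ((x-1)/2)^v`,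
with `(a)_k = a (a+1) ⋯ (a+k-1)`. -/
def jacobiP (α β : ℝ) (j : ℕ) (x : ℝ) : ℝ :=
  ∑ v ∈ Finset.range (j + 1),
    (ascPochhammer ℝ (j - v)).eval (α + v + 1) * (ascPochhammer ℝ v).eval (j + α + β + 1) /
      ((v.factorial : ℝ) * ((j - v).factorial : ℝ)) * ((x - 1) / 2) ^ v

/-- The squared norm `h_j^{(α,β)}` of `P_j^{(α,β)}`,
`h_j = 2^{α+β+1} Γ(j+α+1) Γ(j+β+1) / ((2j+α+β+1) Γ(j+1) Γ(j+α+β+1))`. For `j = 0` the factor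
`(α+β+1) Γ(α+β+1)` is written `Γ(α+β+2)`, so that the value is also right for `α + β + 1 = 0`. -/
def jacobiH (α β : ℝ) (j : ℕ) : ℝ :=
  if j = 0 then
    2 ^ (α + β + 1) * (Real.Gamma (α + 1) * Real.Gamma (β + 1)) / Real.Gamma (α + β + 2)
  else
    2 ^ (α + β + 1) / (2 * j + α + β + 1) *
      (Real.Gamma (j + α + 1) * Real.Gamma (j + β + 1) /
        (Real.Gamma (j + 1) * Real.Gamma (j + α + β + 1)))

/-- The Bessel function of the first kind `J_ν(x)` of real order `ν`, at real `x > 0`. -/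
def besselJ (ν x : ℝ) : ℝ :=
  (x / 2) ^ ν * ∑' k : ℕ,
    (-1 : ℝ) ^ k / ((k.factorial : ℝ) * Real.Gamma (ν + k + 1)) * (x / 2) ^ (2 * k)

/-- The cube `[0, π]^m`. -/
def angleBox (m : ℕ) : Set (Fin m → ℝ) :=
  Set.univ.pi fun _ => Set.Icc 0 Real.pi

/-- The unnormalised joint density on `[0, π]^M` of the eigenangles `θ_1, …, θ_M` of the `2 M`
unconstrained eigenvalues `e^{± i θ_j}`, when `n` eigenvalues are conditioned to lie at `1`. -/
def jointWeight (n M : ℕ) (θ : Fin M → ℝ) : ℝ :=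
  (∏ j, (1 - Real.cos (θ j)) ^ n) *
    ∏ j, ∏ k ∈ Finset.Ioi j, (Real.cos (θ j) - Real.cos (θ k)) ^ 2

/-- The normalisation constant of `jointWeight`. -/
def normConst (n M : ℕ) : ℝ :=
  (∫ θ in angleBox M, jointWeight n M θ)⁻¹

/-- The sum of `f (θ_{j_1}, …, θ_{j_m})` over all `j_1 < ⋯ < j_m`. -/
def levelSum {m M : ℕ} (f : (Fin m → ℝ) → ℝ) (θ : Fin M → ℝ) : ℝ :=
  ∑ J : Fin m ↪o Fin M, f fun i => θ (J i)

/-- The kernel `K_M^{(n-1/2,-1/2)}(θ, φ)`, in which the sum has `M` terms. -/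
def jacobiKernel (n M : ℕ) (θ φ : ℝ) : ℝ :=
  ∑ j ∈ Finset.range M, (jacobiH (n - 1 / 2) (-1 / 2) j)⁻¹ *
    jacobiP (n - 1 / 2) (-1 / 2) j (Real.cos θ) * jacobiP (n - 1 / 2) (-1 / 2) j (Real.cos φ)

/-- The weighted kernel `2^n sin^n(θ/2) sin^n(φ/2) K_M^{(n-1/2,-1/2)}(θ, φ)`. -/
def weightedKernel (n M : ℕ) (θ φ : ℝ) : ℝ :=
  2 ^ n * Real.sin (θ / 2) ^ n * Real.sin (φ / 2) ^ n * jacobiKernel n M θ φ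

/-- The determinant of the weighted kernel, which is to be the `m`-level density. -/
def kernelDet (n M m : ℕ) (θ : Fin m → ℝ) : ℝ :=
  (Matrix.of fun j k : Fin m => weightedKernel n M (θ j) (θ k)).det

/-- The function `ρ` is the `m`-level density of the `M` eigenangles with joint density
proportional to `jointWeight n M`: for every test function `f`, the expectation of the sum of
`f (θ_{j_1}, …, θ_{j_m})` over `j_1 < ⋯ < j_m` exists and is `1 / m!` times the integral of
`f ρ`. -/
def IsLevelDensity (n M m : ℕ) (ρ : (Fin m → ℝ) → ℝ) : Prop :=
  ∀ f : (Fin m → ℝ) → ℝ,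
    IntegrableOn (fun θ => f θ * ρ θ) (angleBox m) →
      IntegrableOn (fun θ : Fin M → ℝ => levelSum f θ * jointWeight n M θ) (angleBox M) ∧
      normConst n M * ∫ θ in angleBox M, levelSum f θ * jointWeight n M θ =
        1 / (m.factorial : ℝ) * ∫ θ in angleBox m, f θ * ρ θ

/-- The limiting Bessel kernel, for `θ ≠ φ`. -/
def besselKernel (n : ℕ) (θ φ : ℝ) : ℝ :=
  √(Real.pi * θ) * √(Real.pi * φ) *
    ((θ * besselJ (n - 3 / 2) (Real.pi * θ) * besselJ (n - 1 / 2) (Real.pi * φ) -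
        φ * besselJ (n - 3 / 2) (Real.pi * φ) * besselJ (n - 1 / 2) (Real.pi * θ)) /
      (φ ^ 2 - θ ^ 2))

/-- The limiting `1`-level density. -/
def besselDensity (n : ℕ) (θ : ℝ) : ℝ :=
  Real.pi ^ 2 / 2 * θ *
    (besselJ (n - 3 / 2) (Real.pi * θ) ^ 2 + besselJ (n - 1 / 2) (Real.pi * θ) ^ 2 -
      (2 * n - 1) / (Real.pi * θ) *
        besselJ (n - 1 / 2) (Real.pi * θ) * besselJ (n - 3 / 2) (Real.pi * θ))

end ConditionedSO

end

noncomputable section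

namespace ConditionedSO

open Finset Polynomial

/-! In the variable `s = (1 - cos θ) / 2` the Jacobi polynomial is a multiple of a terminating `₂F₁`
(`jacobiPoly`), whose coefficients obey a two-term recursion. It is therefore an eigenvector of a
second-order operator, which is symmetric for the weight because consecutive moments have a simple
ratio. Distinct eigenvalues give orthogonality. A three-term recurrence with symmetric coefficients
gives both the norms and the Christoffel-Darboux formula.

The joint density is a squared Vandermonde determinant times a product weight, hence a multiple of
the determinant of the projection kernel of `M` orthonormal functions. By the reproducing property,
integrating one variable out of the determinant of size `k + 1` leaves `M - k` times the determinant
of size `k` (`IsOrthonormal.integral_projDet_cons`). Iteration gives all level densities.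

The scaling limit does not use Christoffel-Darboux. The scaled kernel is a Riemann sum over `j = t
M`; by a Mehler-Heine limit (`tendsto_eval_jacobiPoly`) and an exponential majorant its summands
converge boundedly to `2 u(π θ t) u(π φ t)`, with `u` the function `riccatiBessel n`. On and off the
diagonal alike, the limit is the integral of this over `[0, 1]` (`besselIntegral`). Lagrange's
identity for the Bessel equation evaluates it off the diagonal, continuity in `φ` gives the diagonal
value, and the factor `(z / 2) ^ n` of `u` gives the order of vanishing at `0`. -/

/-! ### Jacobi polynomials as hypergeometric polynomials. -/

/-- The Pochhammer symbol `(1/2)_k`. -/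
def halfPoch (k : ℕ) : ℝ := ∏ i ∈ range k, ((i : ℝ) + 1 / 2)

lemma halfPoch_zero : halfPoch 0 = 1 := by simp [halfPoch]

lemma halfPoch_succ (k : ℕ) : halfPoch (k + 1) = halfPoch k * (k + 1 / 2) := by
  simp [halfPoch, prod_range_succ]

lemma halfPoch_pos (k : ℕ) : 0 < halfPoch k := prod_pos fun i _ => by positivity

lemma halfPoch_ne_zero (k : ℕ) : halfPoch k ≠ 0 := (halfPoch_pos k).ne'

lemma Gamma_nat_add_half' (k : ℕ) : Real.Gamma (k + 1 / 2) = √Real.pi * halfPoch k := by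
  induction k with
  | zero => simp only [Nat.cast_zero, zero_add, halfPoch_zero, mul_one]; exact Real.Gamma_one_half_eq
  | succ k ih =>
    rw [show ((k + 1 : ℕ) : ℝ) + 1 / 2 = (k + 1 / 2) + 1 by push_cast; ring,
      Real.Gamma_add_one (by positivity), ih, halfPoch_succ]
    ring

lemma ascPochhammer_eval_half (m k : ℕ) :
    (ascPochhammer ℝ k).eval ((m : ℝ) + 1 / 2) * halfPoch m = halfPoch (m + k) := by
  induction k with
  | zero => simp
  | succ k ih =>
    rw [ascPochhammer_succ_eval, ← add_assoc, halfPoch_succ, ← ih]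
    push_cast
    ring

/-- The eigenvalue `j (j + n)` of the Jacobi operator. -/
def jacobiEigen (n j : ℕ) : ℝ := j * (j + n)

lemma jacobiEigen_lt {n i j : ℕ} (h : i < j) : jacobiEigen n i < jacobiEigen n j := by
  have h' : (i : ℝ) < j := by exact_mod_cast h
  have : (0 : ℝ) ≤ i := by positivity
  have : (0 : ℝ) ≤ n := by positivity
  unfold jacobiEigen
  nlinarith

lemma jacobiEigen_injective (n : ℕ) : Function.Injective (jacobiEigen n) :=
  (strictMono_nat_of_lt_succ fun k => jacobiEigen_lt (Nat.lt_succ_self k)).injective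

/-- The coefficients of the hypergeometric polynomial `₂F₁(-j, j + n; n + 1/2; s)`. -/
def jacobiCoeff (n j v : ℕ) : ℝ :=
  (∏ i ∈ range v, (jacobiEigen n i - jacobiEigen n j)) * halfPoch n /
    (v.factorial * halfPoch (n + v))

lemma jacobiCoeff_eq_zero {n j v : ℕ} (h : j < v) : jacobiCoeff n j v = 0 := by
  rw [jacobiCoeff, prod_eq_zero (mem_range.2 h) (sub_self _)]
  simp

lemma jacobiCoeff_zero (n j : ℕ) : jacobiCoeff n j 0 = 1 := by
  simp [jacobiCoeff, halfPoch_ne_zero]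

lemma jacobiCoeff_self_ne_zero (n j : ℕ) : jacobiCoeff n j j ≠ 0 := by
  refine div_ne_zero (mul_ne_zero (prod_ne_zero_iff.2 fun i hi => ?_) (halfPoch_ne_zero n)) ?_
  · exact sub_ne_zero.2 (jacobiEigen_lt (mem_range.1 hi)).ne
  · exact mul_ne_zero (by positivity) (halfPoch_ne_zero _)

lemma jacobiCoeff_succ (n j v : ℕ) :
    (v + 1) * (v + n + 1 / 2) * jacobiCoeff n j (v + 1) =
      (jacobiEigen n v - jacobiEigen n j) * jacobiCoeff n j v := by
  have h1 := halfPoch_ne_zero (n + v)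
  have h3 : (n : ℝ) + v + 1 / 2 ≠ 0 := by positivity
  rw [jacobiCoeff, jacobiCoeff, prod_range_succ, Nat.factorial_succ, ← add_assoc, halfPoch_succ]
  push_cast
  rw [show (v : ℝ) + n + 1 / 2 = n + v + 1 / 2 by ring]
  field_simp

/-- The hypergeometric polynomial `₂F₁(-j, j + n; n + 1/2; s)`, which is the Jacobi polynomial
`P_j^{(n-1/2,-1/2)}(1 - 2 s)` up to a factor. -/
def jacobiPoly (n j : ℕ) : ℝ[X] := ∑ v ∈ range (j + 1), monomial v (jacobiCoeff n j v)

lemma coeff_jacobiPoly (n j v : ℕ) : (jacobiPoly n j).coeff v = jacobiCoeff n j v := by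
  rw [jacobiPoly, finsetSum_coeff]
  simp only [coeff_monomial, sum_ite_eq', mem_range]
  split_ifs with h
  · rfl
  · exact (jacobiCoeff_eq_zero (by omega)).symm

lemma jacobiPoly_zero (n : ℕ) : jacobiPoly n 0 = 1 := by
  simp [jacobiPoly, jacobiCoeff_zero]

lemma natDegree_jacobiPoly (n j : ℕ) : (jacobiPoly n j).natDegree = j := by
  refine natDegree_eq_of_le_of_coeff_ne_zero ?_ ?_
  · exact natDegree_le_iff_coeff_eq_zero.2 fun N hN => by
      rw [coeff_jacobiPoly, jacobiCoeff_eq_zero hN]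
  · rw [coeff_jacobiPoly]
    exact jacobiCoeff_self_ne_zero n j

lemma eval_jacobiPoly (n j : ℕ) (s : ℝ) :
    (jacobiPoly n j).eval s = ∑ v ∈ range (j + 1), jacobiCoeff n j v * s ^ v := by
  simp [jacobiPoly, eval_finsetSum]

/-- The value `(n + 1/2)_j / j!` of the Jacobi polynomial at `1`. -/
def jacobiLead (n j : ℕ) : ℝ := halfPoch (n + j) / (halfPoch n * j.factorial)

lemma jacobiLead_ne_zero (n j : ℕ) : jacobiLead n j ≠ 0 :=
  div_ne_zero (halfPoch_ne_zero _) (mul_ne_zero (halfPoch_ne_zero _) (by positivity))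

/-- Since `e_i - e_j = (i - j)(i + j + n)`, the first factors build `(-1)^v j! / (j - v)!` and the
second ones `(j + n)_v`. -/
lemma prod_jacobiEigen_sub {n j v : ℕ} (h : v ≤ j) :
    (∏ i ∈ range v, (jacobiEigen n i - jacobiEigen n j)) * (j - v).factorial =
      (-1) ^ v * j.factorial * (ascPochhammer ℝ v).eval ((j : ℝ) + n) := by
  induction v with
  | zero => simp
  | succ v ih =>
    have h2 : j - v = (j - (v + 1)) + 1 := by omega
    have h3 : ((j - v : ℕ) : ℝ) = j - v := by rw [Nat.cast_sub (by omega)]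
    have ih := ih (by omega)
    rw [h2, Nat.factorial_succ, ← h2] at ih
    push_cast at ih
    rw [prod_range_succ, ascPochhammer_succ_eval, pow_succ]
    rw [h3] at ih
    unfold jacobiEigen at *
    linear_combination (-(j + n + v) : ℝ) * ih

lemma jacobiP_eq (n j : ℕ) (x : ℝ) :
    jacobiP (n - 1 / 2) (-1 / 2) j x = jacobiLead n j * (jacobiPoly n j).eval ((1 - x) / 2) := by
  rw [jacobiP, eval_jacobiPoly, mul_sum]
  refine sum_congr rfl fun v hv => ?_
  have hv : v ≤ j := Nat.lt_succ_iff.1 (mem_range.1 hv)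
  have h1 := ascPochhammer_eval_half (n + v) (j - v)
  rw [show n + v + (j - v) = n + j by omega] at h1
  have h2 := prod_jacobiEigen_sub (n := n) hv
  have e1 : (n : ℝ) - 1 / 2 + v + 1 = ((n + v : ℕ) : ℝ) + 1 / 2 := by push_cast; ring
  have e2 : (j : ℝ) + (n - 1 / 2) + -1 / 2 + 1 = j + n := by ring
  have e3 : ((x - 1) / 2) ^ v = (-1) ^ v * ((1 - x) / 2) ^ v := by rw [← mul_pow]; ring
  have a1 := halfPoch_ne_zero n
  have a2 := halfPoch_ne_zero (n + v)
  have a3 : (j.factorial : ℝ) ≠ 0 := by positivity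
  have a4 : ((j - v).factorial : ℝ) ≠ 0 := by positivity
  rw [e1, e2, e3, jacobiLead, jacobiCoeff, ← h1]
  generalize eval (((n + v : ℕ) : ℝ) + 1 / 2) (ascPochhammer ℝ (j - v)) = E
  generalize ((1 - x) / 2) ^ v = Y
  field_simp
  linear_combination (-(E * Y)) * h2

/-! ### Three-term recurrence, norms and the Christoffel-Darboux formula. -/

/-- The common factor of the recurrence coefficients and the inverse squared norms. -/
def jacobiRho (n j : ℕ) : ℝ :=
  (j + n).factorial * halfPoch (j + n) /
    (2 ^ n * Real.pi * j.factorial * halfPoch j * halfPoch n ^ 2)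

/-- The inverse squared norm of `jacobiPoly n j`. -/
def jacobiInvNorm (n j : ℕ) : ℝ :=
  if j = 0 then jacobiRho n j else (2 * j + n) / (j + n) * jacobiRho n j

/-- The coefficient of the recurrence. -/
def jacobiKappa (n j : ℕ) : ℝ := (j + n + 1 / 2) / (2 * j + n + 1) * jacobiRho n j

lemma jacobiRho_pos (n j : ℕ) : 0 < jacobiRho n j := by
  have := halfPoch_pos (j + n)
  have := halfPoch_pos j
  have := halfPoch_pos n
  have := Real.pi_pos
  unfold jacobiRho
  positivity

lemma jacobiInvNorm_pos (n j : ℕ) : 0 < jacobiInvNorm n j := by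
  have := jacobiRho_pos n j
  unfold jacobiInvNorm
  split_ifs with h
  · exact this
  · have : (0 : ℝ) < j := by exact_mod_cast Nat.pos_of_ne_zero h
    positivity

lemma jacobiKappa_pos (n j : ℕ) : 0 < jacobiKappa n j := by
  have := jacobiRho_pos n j
  unfold jacobiKappa
  positivity

lemma jacobiRho_succ (n j : ℕ) :
    (j + 1) * (j + 1 / 2) * jacobiRho n (j + 1) =
      (j + n + 1) * (j + n + 1 / 2) * jacobiRho n j := by
  have a1 := halfPoch_ne_zero n
  have a2 := halfPoch_ne_zero j
  have a3 : (j : ℝ) + 1 / 2 ≠ 0 := by positivity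
  have a4 := Real.pi_ne_zero
  rw [jacobiRho, jacobiRho, show j + 1 + n = (j + n) + 1 by ring, halfPoch_succ, halfPoch_succ,
    Nat.factorial_succ, Nat.factorial_succ]
  push_cast
  field_simp

lemma jacobiEigen_sub (n i j : ℕ) :
    jacobiEigen n i - jacobiEigen n j = ((i : ℝ) - j) * (i + j + n) := by
  unfold jacobiEigen; ring

/-- The three-term recurrence, compared at `s ^ (v + 1)` with denominators cleared. Differences of
neighbours occur because every polynomial is `1` at `s = 0` while a multiple of `s` vanishes there.
All products reduce to the two common ones over `i < u`, of `i - j` and of `i + j + n + 2`; what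
remains is a polynomial identity. -/
lemma jacobiCoeff_recurrence (n j v : ℕ) :
    (2 * (j + 1) + n) * (2 * (j + 1) + n + 1) * (2 * (j + 1) + n - 1) * jacobiCoeff n (j + 1) v =
      -((2 * (j + 1) + n - 1) * (j + 1 + n) * (j + 1 + n + 1 / 2)) *
          (jacobiCoeff n (j + 2) (v + 1) - jacobiCoeff n (j + 1) (v + 1)) -
        (2 * (j + 1) + n + 1) * (j + 1) * (j + 1 / 2) *
          (jacobiCoeff n j (v + 1) - jacobiCoeff n (j + 1) (v + 1)) := by
  have h1 := halfPoch_ne_zero (n + v)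
  have h2 : (n : ℝ) + v + 1 / 2 ≠ 0 := by positivity
  simp only [jacobiCoeff, jacobiEigen_sub, prod_mul_distrib, Nat.factorial_succ, ← add_assoc,
    halfPoch_succ]
  rcases v with _ | u
  · simp
    field_simp
    ring
  · have e1 : ∏ i ∈ range (u + 2), ((i : ℝ) - (j + 2 : ℕ)) =
        (-(j + 2)) * (-(j + 1)) * ∏ i ∈ range u, ((i : ℝ) - j) := by
      rw [prod_range_succ', prod_range_succ']
      push_cast
      simp only [show ∀ x : ℝ, x + 1 + 1 - (j + 2) = x - j by intro x; ring]
      ring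
    have e2 : ∏ i ∈ range (u + 2), ((i : ℝ) - (j + 1 : ℕ)) =
        (-(j + 1)) * (∏ i ∈ range u, ((i : ℝ) - j)) * (u - j) := by
      rw [prod_range_succ', prod_range_succ]
      push_cast
      simp only [show ∀ x : ℝ, x + 1 - (j + 1) = x - j by intro x; ring]
      ring
    have e3 : ∏ i ∈ range (u + 1), ((i : ℝ) - (j + 1 : ℕ)) =
        (-(j + 1)) * (∏ i ∈ range u, ((i : ℝ) - j)) := by
      rw [prod_range_succ']
      push_cast
      simp only [show ∀ x : ℝ, x + 1 - (j + 1) = x - j by intro x; ring]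
      ring
    have e4 : ∏ i ∈ range (u + 2), ((i : ℝ) - j) =
        (∏ i ∈ range u, ((i : ℝ) - j)) * (u - j) * (u + 1 - j) := by
      rw [prod_range_succ, prod_range_succ]
      push_cast
      ring
    have f1 : ∏ i ∈ range (u + 2), ((i : ℝ) + (j + 2 : ℕ) + n) =
        (∏ i ∈ range u, ((i : ℝ) + j + n + 2)) * (u + j + n + 2) * (u + j + n + 3) := by
      rw [prod_range_succ, prod_range_succ]
      push_cast
      simp only [show ∀ x : ℝ, x + (j + 2) + n = x + j + n + 2 by intro x; ring]
      ring
    have f2 : ∏ i ∈ range (u + 2), ((i : ℝ) + (j + 1 : ℕ) + n) =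
        (j + n + 1) * (∏ i ∈ range u, ((i : ℝ) + j + n + 2)) * (u + j + n + 2) := by
      rw [prod_range_succ', prod_range_succ]
      push_cast
      simp only [show ∀ x : ℝ, x + 1 + (j + 1) + n = x + j + n + 2 by intro x; ring]
      ring
    have f3 : ∏ i ∈ range (u + 1), ((i : ℝ) + (j + 1 : ℕ) + n) =
        (j + n + 1) * (∏ i ∈ range u, ((i : ℝ) + j + n + 2)) := by
      rw [prod_range_succ']
      push_cast
      simp only [show ∀ x : ℝ, x + 1 + (j + 1) + n = x + j + n + 2 by intro x; ring]
      ring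
    have f4 : ∏ i ∈ range (u + 2), ((i : ℝ) + j + n) =
        (j + n) * (j + n + 1) * (∏ i ∈ range u, ((i : ℝ) + j + n + 2)) := by
      rw [prod_range_succ', prod_range_succ']
      push_cast
      simp only [show ∀ x : ℝ, x + 1 + 1 + j + n = x + j + n + 2 by intro x; ring]
      ring
    rw [show u + 1 + 1 = u + 2 from rfl, e1, e2, e3, e4, f1, f2, f3, f4]
    generalize (∏ i ∈ range u, ((i : ℝ) - j)) = A
    generalize (∏ i ∈ range u, ((i : ℝ) + j + n + 2)) = B
    have h3 : ((u + 1 : ℕ).factorial : ℝ) ≠ 0 := by positivity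
    push_cast at *
    field_simp
    ring

/-- There is no predecessor at `j = 0`, and the quotient `(2 j + n) / (j + n)` has to be read as `1`
there, even for `n = 0`. -/
lemma jacobiPoly_recurrence_zero (n : ℕ) :
    C (jacobiInvNorm n 0) * (X * jacobiPoly n 0) =
      -(C (jacobiKappa n 0) * (jacobiPoly n 1 - jacobiPoly n 0)) := by
  have h1 : jacobiPoly n 1 = 1 + C (jacobiCoeff n 1 1) * X := by
    simp [jacobiPoly, sum_range_succ, jacobiCoeff_zero, C_mul_X_eq_monomial]
  have h2 := jacobiCoeff_succ n 1 0
  simp only [jacobiEigen, jacobiCoeff_zero] at h2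
  have h3 : jacobiInvNorm n 0 = -(jacobiKappa n 0 * jacobiCoeff n 1 1) := by
    have : (n : ℝ) + 1 ≠ 0 := by positivity
    rw [jacobiInvNorm, jacobiKappa, if_pos rfl]
    push_cast at *
    field_simp
    linear_combination (2 * jacobiRho n 0) * h2
  rw [jacobiPoly_zero, h1, h3]
  simp only [map_neg, map_mul]
  ring

lemma jacobiPoly_recurrence_succ (n j : ℕ) :
    C (jacobiInvNorm n (j + 1)) * (X * jacobiPoly n (j + 1)) =
      -(C (jacobiKappa n (j + 1)) * (jacobiPoly n (j + 2) - jacobiPoly n (j + 1))) -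
        C (jacobiKappa n j) * (jacobiPoly n j - jacobiPoly n (j + 1)) := by
  ext v
  rcases v with _ | v
  · simp [coeff_jacobiPoly, jacobiCoeff_zero]
  · simp only [coeff_C_mul, coeff_X_mul, coeff_sub, coeff_neg, coeff_jacobiPoly]
    have h1 := jacobiCoeff_recurrence n j v
    have h2 := jacobiRho_succ n j
    have p1 : (j : ℝ) + 1 + n ≠ 0 := by positivity
    have p2 : 2 * ((j : ℝ) + 1) + n + 1 ≠ 0 := by positivity
    have p3 : 2 * (j : ℝ) + n + 1 ≠ 0 := by positivity
    have p4 : (j : ℝ) + n + 1 / 2 ≠ 0 := by positivity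
    have h3 : jacobiRho n j =
        (j + 1) * (j + 1 / 2) * jacobiRho n (j + 1) / ((j + 1 + n) * (j + n + 1 / 2)) := by
      rw [h2]; field_simp; ring
    rw [jacobiInvNorm, if_neg (Nat.succ_ne_zero j), jacobiKappa, jacobiKappa, h3]
    push_cast
    generalize jacobiCoeff n (j + 1) v = a at *
    generalize jacobiCoeff n (j + 1) (v + 1) = b at *
    generalize jacobiCoeff n (j + 2) (v + 1) = c at *
    generalize jacobiCoeff n j (v + 1) = d at *
    generalize jacobiRho n (j + 1) = R at *
    clear h2 h3
    field_simp
    linear_combination (2 * R) * h1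

/-- Multiply the recurrence at `s` by the value at `t` and subtract the same with `s` and `t`
exchanged. The diagonal terms cancel, and as the same `jacobiKappa n j` couples `j` to `j + 1` and
`j + 1` to `j`, the sum telescopes. -/
lemma christoffel_darboux_jacobiPoly (n M : ℕ) (s t : ℝ) :
    (s - t) * ∑ j ∈ range (M + 1),
        jacobiInvNorm n j * (jacobiPoly n j).eval s * (jacobiPoly n j).eval t =
      -(jacobiKappa n M * ((jacobiPoly n (M + 1)).eval s * (jacobiPoly n M).eval t -
        (jacobiPoly n M).eval s * (jacobiPoly n (M + 1)).eval t)) := by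
  induction M with
  | zero =>
    have h1 := congrArg (eval s) (jacobiPoly_recurrence_zero n)
    have h2 := congrArg (eval t) (jacobiPoly_recurrence_zero n)
    simp only [eval_mul, eval_C, eval_X, eval_neg, eval_sub] at h1 h2
    rw [sum_range_one]
    linear_combination (eval t (jacobiPoly n 0)) * h1 - (eval s (jacobiPoly n 0)) * h2
  | succ M ih =>
    have h1 := congrArg (eval s) (jacobiPoly_recurrence_succ n M)
    have h2 := congrArg (eval t) (jacobiPoly_recurrence_succ n M)
    simp only [eval_mul, eval_C, eval_X, eval_neg, eval_sub] at h1 h2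
    rw [sum_range_succ, mul_add, ih]
    linear_combination (eval t (jacobiPoly n (M + 1))) * h1 -
      (eval s (jacobiPoly n (M + 1))) * h2

lemma jacobiH_eq (n j : ℕ) :
    jacobiH (n - 1 / 2) (-1 / 2) j = jacobiLead n j ^ 2 / jacobiInvNorm n j := by
  have a1 := halfPoch_ne_zero n
  have a2 := halfPoch_ne_zero j
  have a3 := halfPoch_ne_zero (n + j)
  have a4 := Real.pi_ne_zero
  have e0 : (n : ℝ) - 1 / 2 + -1 / 2 + 1 = n := by ring
  have hp : √Real.pi * √Real.pi = Real.pi := Real.mul_self_sqrt Real.pi_pos.le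
  rw [jacobiH, jacobiInvNorm, jacobiLead, jacobiRho]
  split_ifs with h
  · subst h
    rw [e0, Real.rpow_natCast, show (n : ℝ) - 1 / 2 + 1 = n + 1 / 2 by ring,
      show (n : ℝ) - 1 / 2 + -1 / 2 + 2 = n + 1 by ring, show (-1 / 2 : ℝ) + 1 = (0 : ℕ) + 1 / 2 by
        norm_num, Gamma_nat_add_half', Gamma_nat_add_half', Real.Gamma_nat_eq_factorial]
    simp only [zero_add, add_zero, Nat.factorial_zero, halfPoch_zero, Nat.cast_one]
    field_simp
    linear_combination hp
  · have hj : (0 : ℝ) < j := by exact_mod_cast Nat.pos_of_ne_zero h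
    have hjn : (0 : ℝ) < j + n := by positivity
    -- This form avoids the factorial of `j + n - 1` with its truncated subtraction.
    have hG : Real.Gamma ((j : ℝ) + n) * (j + n) = (j + n).factorial := by
      rw [mul_comm, ← Real.Gamma_add_one hjn.ne', ← Nat.cast_add, Real.Gamma_nat_eq_factorial]
    have hG0 : Real.Gamma ((j : ℝ) + n) ≠ 0 := (Real.Gamma_pos_of_pos hjn).ne'
    rw [e0, Real.rpow_natCast, show (j : ℝ) + (n - 1 / 2) + 1 = ((n + j : ℕ) : ℝ) + 1 / 2 by
        push_cast; ring, show (j : ℝ) + -1 / 2 + 1 = j + 1 / 2 by ring,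
      show (j : ℝ) + (n - 1 / 2) + -1 / 2 + 1 = j + n by ring,
      show 2 * (j : ℝ) + (n - 1 / 2) + -1 / 2 + 1 = 2 * j + n by ring,
      Gamma_nat_add_half', Gamma_nat_add_half', Real.Gamma_nat_eq_factorial, ← hG, add_comm j n]
    field_simp
    linear_combination hp

lemma jacobiKernel_eq (n M : ℕ) (θ φ : ℝ) :
    jacobiKernel n M θ φ = ∑ j ∈ range M, jacobiInvNorm n j *
      (jacobiPoly n j).eval ((1 - Real.cos θ) / 2) *
        (jacobiPoly n j).eval ((1 - Real.cos φ) / 2) := by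
  refine sum_congr rfl fun j _ => ?_
  have := jacobiLead_ne_zero n j
  have := (jacobiInvNorm_pos n j).ne'
  rw [jacobiH_eq, jacobiP_eq, jacobiP_eq]
  field_simp

lemma christoffel_darboux (n M : ℕ) (θ φ : ℝ) (h : Real.cos θ ≠ Real.cos φ) :
    jacobiKernel n (M + 1) θ φ =
      2 ^ (1 - n : ℝ) / (2 * M + n + 1) *
        (Real.Gamma (M + 2) * Real.Gamma (M + n + 1) /
          (Real.Gamma (M + n + 1 / 2) * Real.Gamma (M + 1 / 2))) *
        ((jacobiP (n - 1 / 2) (-1 / 2) (M + 1) (Real.cos θ) *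
              jacobiP (n - 1 / 2) (-1 / 2) M (Real.cos φ) -
            jacobiP (n - 1 / 2) (-1 / 2) M (Real.cos θ) *
              jacobiP (n - 1 / 2) (-1 / 2) (M + 1) (Real.cos φ)) /
          (Real.cos θ - Real.cos φ)) := by
  have h0 := sub_ne_zero.2 h
  have h1 := christoffel_darboux_jacobiPoly n M ((1 - Real.cos θ) / 2) ((1 - Real.cos φ) / 2)
  rw [← jacobiKernel_eq] at h1
  have a1 := halfPoch_ne_zero n
  have a2 := halfPoch_ne_zero M
  have a3 := halfPoch_ne_zero (M + n)
  have a4 := Real.pi_ne_zero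
  have hp : √Real.pi ^ 2 = Real.pi := Real.sq_sqrt Real.pi_pos.le
  -- The `2` on the right comes from `cos θ - cos φ = -2 (s - t)`.
  have hc : 2 ^ (1 - n : ℝ) / (2 * M + n + 1) *
        (Real.Gamma (M + 2) * Real.Gamma (M + n + 1) /
          (Real.Gamma (M + n + 1 / 2) * Real.Gamma (M + 1 / 2))) *
        (jacobiLead n M * jacobiLead n (M + 1)) = 2 * jacobiKappa n M := by
    rw [Real.rpow_sub two_pos, Real.rpow_one, Real.rpow_natCast,
      show (M : ℝ) + 2 = (M + 1 : ℕ) + 1 by push_cast; ring, ← Nat.cast_add M n,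
      Gamma_nat_add_half', Gamma_nat_add_half', Real.Gamma_nat_eq_factorial,
      Real.Gamma_nat_eq_factorial, jacobiLead, jacobiLead, jacobiKappa, jacobiRho,
      ← add_assoc n M 1, halfPoch_succ, add_comm n M]
    push_cast
    rw [show ∀ a b : ℝ, √Real.pi * a * (√Real.pi * b) = Real.pi * a * b by
      intro a b; linear_combination a * b * hp]
    field_simp
  simp only [jacobiP_eq]
  rw [← mul_div_assoc, eq_div_iff h0]
  generalize eval ((1 - Real.cos θ) / 2) (jacobiPoly n (M + 1)) = A at *
  generalize eval ((1 - Real.cos θ) / 2) (jacobiPoly n M) = B at *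
  generalize eval ((1 - Real.cos φ) / 2) (jacobiPoly n (M + 1)) = A' at *
  generalize eval ((1 - Real.cos φ) / 2) (jacobiPoly n M) = B' at *
  linear_combination (-2 : ℝ) * h1 - (A * B' - B * A') * hc

/-! ### Moments of the weight and orthogonality. -/

/-- The function `((1 - cos θ) / 2) ^ N * sin θ` vanishes at both ends, so its derivative integrates
to `0`, which relates the moments `N` and `N + 1`. -/
lemma integral_half_one_sub_cos_pow (N : ℕ) :
    ∫ θ in (0 : ℝ)..Real.pi, ((1 - Real.cos θ) / 2) ^ N =
      Real.pi * halfPoch N / N.factorial := by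
  induction N with
  | zero => simp [halfPoch_zero]
  | succ N ih =>
    have hd : ∀ θ : ℝ, HasDerivAt (fun θ => ((1 - Real.cos θ) / 2) ^ N * Real.sin θ)
        ((2 * N + 1) * ((1 - Real.cos θ) / 2) ^ N -
          (2 * N + 2) * ((1 - Real.cos θ) / 2) ^ (N + 1)) θ := by
      intro θ
      have h1 : HasDerivAt (fun θ => (1 - Real.cos θ) / 2) (Real.sin θ / 2) θ := by
        simpa using ((Real.hasDerivAt_cos θ).const_sub 1).div_const 2
      have h2 := (h1.pow N).mul (Real.hasDerivAt_sin θ)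
      refine h2.congr_deriv ?_
      have h3 := Real.sin_sq_add_cos_sq θ
      rcases N with _ | N
      · simp; ring
      · simp only [Nat.add_sub_cancel, pow_succ, Pi.pow_apply]
        push_cast
        linear_combination ((N + 1) / 2 * ((1 - Real.cos θ) / 2) ^ N) * h3
    have hi := intervalIntegral.integral_eq_sub_of_hasDerivAt (a := 0) (b := Real.pi)
      (fun θ _ => hd θ) (Continuous.intervalIntegrable (by fun_prop) _ _)
    rw [intervalIntegral.integral_sub (Continuous.intervalIntegrable (by fun_prop) _ _)
      (Continuous.intervalIntegrable (by fun_prop) _ _), intervalIntegral.integral_const_mul,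
      intervalIntegral.integral_const_mul, ih] at hi
    simp only [Real.sin_pi, Real.sin_zero, mul_zero, sub_zero] at hi
    rw [halfPoch_succ, Nat.factorial_succ, eq_div_iff (by positivity)]
    push_cast
    have : (N.factorial : ℝ) ≠ 0 := by positivity
    field_simp at hi ⊢
    linear_combination (-1 : ℝ) * hi

/-- Integration of a polynomial in `(1 - cos θ) / 2` against the weight `(1 - cos θ) ^ n`. -/
def weightIntegral (n : ℕ) : ℝ[X] →ₗ[ℝ] ℝ where
  toFun p := ∫ θ in (0 : ℝ)..Real.pi, p.eval ((1 - Real.cos θ) / 2) * (1 - Real.cos θ) ^ n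
  map_add' p q := by
    have h : ∀ p : ℝ[X], IntervalIntegrable
        (fun θ => p.eval ((1 - Real.cos θ) / 2) * (1 - Real.cos θ) ^ n) volume 0 Real.pi :=
      fun p => Continuous.intervalIntegrable
        ((p.continuous.comp (by fun_prop)).mul (by fun_prop)) _ _
    simp only [eval_add, add_mul]
    exact intervalIntegral.integral_add (h p) (h q)
  map_smul' c p := by
    simp only [eval_smul, smul_eq_mul, mul_assoc, RingHom.id_apply,
      intervalIntegral.integral_const_mul]

lemma weightIntegral_apply (n : ℕ) (p : ℝ[X]) : weightIntegral n p =
    ∫ θ in (0 : ℝ)..Real.pi, p.eval ((1 - Real.cos θ) / 2) * (1 - Real.cos θ) ^ n := rfl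

lemma weightIntegral_X_pow (n k : ℕ) :
    weightIntegral n (X ^ k) = 2 ^ n * (Real.pi * halfPoch (k + n) / (k + n).factorial) := by
  rw [weightIntegral_apply, ← integral_half_one_sub_cos_pow, ← intervalIntegral.integral_const_mul]
  refine intervalIntegral.integral_congr fun θ _ => ?_
  simp only [eval_pow, eval_X]
  rw [pow_add, div_pow (1 - Real.cos θ) 2 n]
  field_simp

lemma weightIntegral_X_pow_succ (n k : ℕ) :
    (k + n + 1) * weightIntegral n (X ^ (k + 1)) =
      (k + n + 1 / 2) * weightIntegral n (X ^ k) := by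
  rw [weightIntegral_X_pow, weightIntegral_X_pow, show k + 1 + n = k + n + 1 by ring,
    halfPoch_succ, Nat.factorial_succ]
  push_cast
  field_simp

/-- The Jacobi differential operator, in the variable `s = (1 - x) / 2`. -/
def jacobiOp (n : ℕ) (p : ℝ[X]) : ℝ[X] :=
  X * derivative (derivative p) - X * (X * derivative (derivative p)) +
    C ((n : ℝ) + 1 / 2) * derivative p - C ((n : ℝ) + 1) * (X * derivative p)

lemma jacobiOp_add (n : ℕ) (p q : ℝ[X]) :
    jacobiOp n (p + q) = jacobiOp n p + jacobiOp n q := by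
  simp only [jacobiOp, derivative_add]; ring

lemma jacobiOp_C_mul (n : ℕ) (a : ℝ) (p : ℝ[X]) :
    jacobiOp n (C a * p) = C a * jacobiOp n p := by
  simp only [jacobiOp, derivative_C_mul]; ring

/-- On coefficients the operator is bidiagonal, so its eigenvector equation is exactly the recursion
`jacobiCoeff_succ`. -/
lemma coeff_jacobiOp (n : ℕ) (p : ℝ[X]) (v : ℕ) : (jacobiOp n p).coeff v =
    (v + 1) * (v + n + 1 / 2) * p.coeff (v + 1) - jacobiEigen n v * p.coeff v := by
  rcases v with _ | _ | v <;>
  simp only [jacobiOp, jacobiEigen, coeff_add, coeff_sub, coeff_C_mul, coeff_X_mul,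
    coeff_X_mul_zero, coeff_derivative] <;> push_cast <;> ring

lemma jacobiOp_jacobiPoly (n j : ℕ) :
    jacobiOp n (jacobiPoly n j) = C (-jacobiEigen n j) * jacobiPoly n j := by
  ext v
  rw [coeff_jacobiOp, coeff_C_mul, coeff_jacobiPoly, coeff_jacobiPoly, jacobiCoeff_succ]
  ring

lemma jacobiOp_one (n : ℕ) : jacobiOp n 1 = 0 := by simp [jacobiOp]

lemma jacobiOp_X_pow_succ (n k : ℕ) : jacobiOp n (X ^ (k + 1)) =
    C ((k + 1) * (k + n + 1 / 2) : ℝ) * X ^ k - C (jacobiEigen n (k + 1)) * X ^ (k + 1) := by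
  ext v
  rw [coeff_jacobiOp]
  simp only [coeff_sub, coeff_C_mul, coeff_X_pow, add_left_inj]
  split_ifs with h1 h2 h2
  · omega
  · subst h1; ring
  · subst h2; ring
  · ring

/-- Symmetry on monomials needs no integration by parts: both sides involve two consecutive moments,
and the moment ratio makes them agree. -/
lemma weightIntegral_jacobiOp_X_pow (n k l : ℕ) :
    weightIntegral n (jacobiOp n (X ^ k) * X ^ l) =
      weightIntegral n (X ^ k * jacobiOp n (X ^ l)) := by
  have hC : ∀ (a : ℝ) (p : ℝ[X]), weightIntegral n (C a * p) = a * weightIntegral n p := by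
    intro a p; rw [← smul_eq_C_mul, map_smul, smul_eq_mul]
  have aux : ∀ l : ℕ, weightIntegral n (jacobiOp n (X ^ (l + 1))) = 0 := by
    intro l
    rw [jacobiOp_X_pow_succ, map_sub, hC, hC, jacobiEigen]
    have := weightIntegral_X_pow_succ n l
    push_cast
    linear_combination (-(l + 1 : ℝ)) * this
  rcases k with _ | k <;> rcases l with _ | l
  · simp [jacobiOp_one]
  · simp [jacobiOp_one, aux]
  · simp [jacobiOp_one, aux]
  · rw [jacobiOp_X_pow_succ, jacobiOp_X_pow_succ, sub_mul, mul_sub, map_sub, map_sub, mul_assoc,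
      mul_assoc, mul_left_comm _ (C _), mul_left_comm _ (C _), hC, hC, hC, hC, ← pow_add, ← pow_add,
      ← pow_add, show k + 1 + (l + 1) = k + l + 1 + 1 by ring, show k + (l + 1) = k + l + 1 by ring,
      show k + 1 + l = k + l + 1 by ring, jacobiEigen, jacobiEigen]
    have := weightIntegral_X_pow_succ n (k + l + 1)
    push_cast at *
    linear_combination ((l : ℝ) - k) * this

lemma weightIntegral_jacobiOp (n : ℕ) (p q : ℝ[X]) :
    weightIntegral n (jacobiOp n p * q) = weightIntegral n (p * jacobiOp n q) := by
  induction p using Polynomial.induction_on' with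
  | add p₁ p₂ h₁ h₂ => simp only [jacobiOp_add, add_mul, map_add, h₁, h₂]
  | monomial k a =>
    induction q using Polynomial.induction_on' with
    | add q₁ q₂ h₁ h₂ => simp only [jacobiOp_add, mul_add, map_add, h₁, h₂]
    | monomial l b =>
      rw [← C_mul_X_pow_eq_monomial, ← C_mul_X_pow_eq_monomial, jacobiOp_C_mul, jacobiOp_C_mul]
      have := congrArg (fun x => a * b * x) (weightIntegral_jacobiOp_X_pow n k l)
      simp only [← smul_eq_mul, ← map_smul, smul_eq_C_mul] at this
      convert this using 2 <;> simp only [smul_eq_mul, map_mul] <;> ring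

lemma weightIntegral_jacobiPoly_of_ne (n : ℕ) {i j : ℕ} (h : i ≠ j) :
    weightIntegral n (jacobiPoly n i * jacobiPoly n j) = 0 := by
  have h1 := weightIntegral_jacobiOp n (jacobiPoly n i) (jacobiPoly n j)
  rw [jacobiOp_jacobiPoly, jacobiOp_jacobiPoly, mul_assoc, mul_left_comm (jacobiPoly n i) (C _),
    ← smul_eq_C_mul, ← smul_eq_C_mul, map_smul, map_smul, smul_eq_mul, smul_eq_mul] at h1
  have h2 := sub_ne_zero.2 ((jacobiEigen_injective n).ne h)
  refine (mul_eq_zero.1 ?_).resolve_left h2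
  linear_combination (-1 : ℝ) * h1

/-- The integral of `s P_j P_{j+1}` is computed twice, by the recurrence for `s P_j` and by that for
`s P_{j+1}`. The shared coefficient `jacobiKappa n j` cancels, so the product of `jacobiInvNorm` and
the squared norm does not depend on `j`. -/
lemma weightIntegral_jacobiPoly_self (n j : ℕ) :
    jacobiInvNorm n j * weightIntegral n (jacobiPoly n j * jacobiPoly n j) = 1 := by
  have hC : ∀ (a : ℝ) (p : ℝ[X]), weightIntegral n (C a * p) = a * weightIntegral n p := by
    intro a p; rw [← smul_eq_C_mul, map_smul, smul_eq_mul]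
  induction j with
  | zero =>
    have := weightIntegral_X_pow n 0
    rw [pow_zero] at this
    have a1 := halfPoch_ne_zero n
    have a4 := Real.pi_ne_zero
    rw [jacobiPoly_zero, mul_one, this, jacobiInvNorm, if_pos rfl, jacobiRho]
    simp only [zero_add, Nat.factorial_zero, Nat.cast_one, halfPoch_zero]
    field_simp
  | succ j ih =>
    have h1 : jacobiInvNorm n j * weightIntegral n (X * jacobiPoly n j * jacobiPoly n (j + 1)) =
        -(jacobiKappa n j *
          weightIntegral n (jacobiPoly n (j + 1) * jacobiPoly n (j + 1))) := by
      rcases j with _ | j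
      · have := congrArg (fun p => weightIntegral n (p * jacobiPoly n 1))
          (jacobiPoly_recurrence_zero n)
        simp only [neg_mul, mul_assoc, sub_mul, mul_sub, map_sub, map_neg, hC,
          weightIntegral_jacobiPoly_of_ne n zero_ne_one] at this ⊢
        linear_combination this
      · have := congrArg (fun p => weightIntegral n (p * jacobiPoly n (j + 2)))
          (jacobiPoly_recurrence_succ n j)
        simp only [neg_mul, mul_assoc, sub_mul, mul_sub, map_sub, map_neg, hC,
          weightIntegral_jacobiPoly_of_ne n (show j ≠ j + 2 by omega),
          weightIntegral_jacobiPoly_of_ne n (show j + 1 ≠ j + 2 by omega)] at this ⊢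
        linear_combination this
    have h2 : jacobiInvNorm n (j + 1) *
        weightIntegral n (X * jacobiPoly n j * jacobiPoly n (j + 1)) =
        -(jacobiKappa n j * weightIntegral n (jacobiPoly n j * jacobiPoly n j)) := by
      have := congrArg (fun p => weightIntegral n (p * jacobiPoly n j))
        (jacobiPoly_recurrence_succ n j)
      simp only [neg_mul, mul_assoc, sub_mul, mul_sub, map_sub, map_neg, hC,
        weightIntegral_jacobiPoly_of_ne n (show j + 2 ≠ j by omega),
        weightIntegral_jacobiPoly_of_ne n (show j ≠ j + 1 by omega),
        mul_comm (jacobiPoly n (j + 1))] at this ⊢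
      linear_combination this
    have h3 := (jacobiKappa_pos n j).ne'
    refine mul_left_cancel₀ h3 ?_
    linear_combination jacobiInvNorm n (j + 1) * h1 - jacobiInvNorm n j * h2 +
      jacobiKappa n j * ih

lemma weightIntegral_jacobiPoly (n i j : ℕ) :
    weightIntegral n (jacobiPoly n i * jacobiPoly n j) =
      if i = j then (jacobiInvNorm n i)⁻¹ else 0 := by
  split_ifs with h
  · subst h
    exact eq_inv_of_mul_eq_one_right (weightIntegral_jacobiPoly_self n i)
  · exact weightIntegral_jacobiPoly_of_ne n h

lemma integral_jacobiP_mul_jacobiP (n i j : ℕ) :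
    ∫ θ in (0 : ℝ)..Real.pi, jacobiP (n - 1 / 2) (-1 / 2) i (Real.cos θ) *
        jacobiP (n - 1 / 2) (-1 / 2) j (Real.cos θ) * (1 - Real.cos θ) ^ n =
      if i = j then jacobiH (n - 1 / 2) (-1 / 2) i else 0 := by
  have h : ∀ θ, jacobiP (n - 1 / 2) (-1 / 2) i (Real.cos θ) *
        jacobiP (n - 1 / 2) (-1 / 2) j (Real.cos θ) * (1 - Real.cos θ) ^ n =
      jacobiLead n i * jacobiLead n j * ((jacobiPoly n i * jacobiPoly n j).eval
        ((1 - Real.cos θ) / 2) * (1 - Real.cos θ) ^ n) := by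
    intro θ
    rw [jacobiP_eq, jacobiP_eq, eval_mul]
    ring
  simp only [h]
  rw [intervalIntegral.integral_const_mul, ← weightIntegral_apply, weightIntegral_jacobiPoly,
    jacobiH_eq]
  split_ifs with hij
  · subst hij; ring
  · simp

/-! ### Determinants of projection kernels (the Dyson-Gaudin integration lemma). -/

section Determinantal

variable {α : Type*} {N : ℕ}

/-- The projection kernel of a finite family of functions. -/
def projKernel (φ : Fin N → α → ℝ) (x y : α) : ℝ := ∑ i, φ i x * φ i y

/-- The determinant of the projection kernel of a finite family of functions. -/
def projDet (φ : Fin N → α → ℝ) (k : ℕ) (θ : Fin k → α) : ℝ :=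
  (Matrix.of fun i j => projKernel φ (θ i) (θ j)).det

/-- The Gram factorisation is the source of nonnegativity, of the rank bound, and of the squared
determinant when `k = N`. -/
lemma projKernel_matrix_eq (φ : Fin N → α → ℝ) {k : ℕ} (θ : Fin k → α) :
    (Matrix.of fun i j => projKernel φ (θ i) (θ j)) =
      (Matrix.of fun i l => φ l (θ i)) *
        (Matrix.of fun i l => φ l (θ i)).conjTranspose := by
  ext i j
  simp [Matrix.mul_apply, projKernel]

lemma projDet_comp_equiv (φ : Fin N → α → ℝ) {k l : ℕ} (θ : Fin k → α) (e : Fin l ≃ Fin k) :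
    projDet φ l (θ ∘ e) = projDet φ k θ := by
  rw [projDet, projDet, ← Matrix.det_submatrix_equiv_self e]
  rfl

lemma projDet_nonneg (φ : Fin N → α → ℝ) (k : ℕ) (θ : Fin k → α) : 0 ≤ projDet φ k θ := by
  rw [projDet, projKernel_matrix_eq]
  exact (Matrix.posSemidef_self_mul_conjTranspose _).det_nonneg

lemma projDet_eq_zero_of_lt (φ : Fin N → α → ℝ) {k : ℕ} (h : N < k) (θ : Fin k → α) :
    projDet φ k θ = 0 := by
  by_contra h0
  have h1 := Matrix.rank_of_isUnit _ ((Matrix.isUnit_iff_isUnit_det _).2 (isUnit_iff_ne_zero.2 h0))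
  rw [projKernel_matrix_eq, Fintype.card_fin] at h1
  have h2 := (Matrix.rank_mul_le_left (Matrix.of fun i l => φ l (θ i))
    (Matrix.of fun i l => φ l (θ i)).conjTranspose).trans (Matrix.rank_le_card_width _)
  rw [h1, Fintype.card_fin] at h2
  omega

lemma projDet_self (φ : Fin N → α → ℝ) (θ : Fin N → α) :
    projDet φ N θ = (Matrix.of fun i l => φ l (θ i)).det ^ 2 := by
  rw [projDet, projKernel_matrix_eq, Matrix.det_mul, Matrix.det_conjTranspose, star_trivial, sq]

/-- A left null vector of the Gram matrix annihilates its factor; extended by `0` it still does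
after a point is added. This allows division by `projDet φ k` in the measurability argument below.
-/
lemma projDet_cons_eq_zero (φ : Fin N → α → ℝ) {k : ℕ} {θ : Fin k → α}
    (h : projDet φ k θ = 0) (t : α) : projDet φ (k + 1) (Fin.cons t θ : Fin (k + 1) → α) = 0 := by
  rw [projDet, projKernel_matrix_eq, ← Matrix.exists_vecMul_eq_zero_iff] at h ⊢
  obtain ⟨v, hv, h⟩ := h
  rw [Matrix.vecMul_self_mul_conjTranspose_eq_zero] at h
  refine ⟨Fin.cons 0 v, fun h0 => hv (funext fun i => ?_), ?_⟩
  · simpa using congrFun h0 i.succ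
  · rw [Matrix.vecMul_self_mul_conjTranspose_eq_zero]
    ext l
    have := congrFun h l
    simpa [Matrix.vecMul, dotProduct, Fin.sum_univ_succ] using this

lemma projDet_cons_removeNth (φ : Fin N → α → ℝ) {k : ℕ} (p : Fin (k + 1))
    (θ : Fin (k + 1) → α) :
    projDet φ (k + 1) (Fin.cons (θ p) (p.removeNth θ) : Fin (k + 1) → α) =
      projDet φ (k + 1) θ := by
  rw [← projDet_comp_equiv φ θ ((finSuccEquiv' 0).trans (finSuccEquiv' p).symm)]
  congr 1
  funext i
  induction i using Fin.cases with
  | zero => simp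
  | succ i =>
    have : finSuccEquiv' (0 : Fin (k + 1)) i.succ = some i := by
      rw [← Fin.zero_succAbove, finSuccEquiv'_succAbove]
    simp [this, Fin.removeNth]

variable [MeasurableSpace α]

lemma measurable_projKernel {φ : Fin N → α → ℝ} (hφ : ∀ i, Measurable (φ i)) {β : Type*}
    [MeasurableSpace β] {f g : β → α} (hf : Measurable f) (hg : Measurable g) :
    Measurable fun x => projKernel φ (f x) (g x) :=
  Finset.measurable_sum _ fun i _ => ((hφ i).comp hf).mul ((hφ i).comp hg)

lemma measurable_projDet {φ : Fin N → α → ℝ} (hφ : ∀ i, Measurable (φ i)) (k : ℕ) :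
    Measurable (projDet φ k) := by
  unfold projDet
  simp only [Matrix.det_apply, Matrix.of_apply]
  exact Finset.measurable_sum _ fun σ _ => (Finset.measurable_prod _ fun i _ =>
    measurable_projKernel hφ (measurable_pi_apply _) (measurable_pi_apply _)).const_smul
      (Equiv.Perm.sign σ)

variable {μ : Measure α} {φ : Fin N → α → ℝ}

/-- The functions are orthonormal, with integrable products. -/
def IsOrthonormal (μ : Measure α) (φ : Fin N → α → ℝ) : Prop :=
  ∀ i j, Integrable (fun t => φ i t * φ j t) μ ∧ ∫ t, φ i t * φ j t ∂μ = if i = j then 1 else 0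

lemma IsOrthonormal.integral_projKernel_self (h : IsOrthonormal μ φ) :
    Integrable (fun t => projKernel φ t t) μ ∧ ∫ t, projKernel φ t t ∂μ = N := by
  refine ⟨integrable_finsetSum _ fun i _ => (h i i).1, ?_⟩
  simp only [projKernel]
  rw [integral_finsetSum _ fun i _ => (h i i).1]
  simp [(h _ _).2]

lemma IsOrthonormal.integral_projKernel_mul (h : IsOrthonormal μ φ) (x y : α) :
    Integrable (fun t => projKernel φ x t * projKernel φ t y) μ ∧
      ∫ t, projKernel φ x t * projKernel φ t y ∂μ = projKernel φ x y := by
  have h1 : ∀ t, projKernel φ x t * projKernel φ t y =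
      ∑ i, ∑ j, φ i x * φ j y * (φ i t * φ j t) := by
    intro t
    rw [projKernel, projKernel, sum_mul_sum]
    exact sum_congr rfl fun i _ => sum_congr rfl fun j _ => by ring
  have h2 : ∀ i j, Integrable (fun t => φ i x * φ j y * (φ i t * φ j t)) μ :=
    fun i j => (h i j).1.const_mul _
  simp only [h1]
  refine ⟨integrable_finsetSum _ fun i _ => integrable_finsetSum _ fun j _ => h2 i j, ?_⟩
  rw [integral_finsetSum _ fun i _ => integrable_finsetSum _ fun j _ => h2 i j]
  simp only [integral_finsetSum _ fun j _ => h2 _ j, integral_const_mul, (h _ _).2]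
  simp [projKernel]

/-- A permutation of `k + 1` points either fixes the new point, whose factor `K(t, t)` integrates to
`N`, or inserts it into a cycle of `e`, where the reproducing property removes it again. -/
lemma IsOrthonormal.integral_prod_decomposeFin (h : IsOrthonormal μ φ) {k : ℕ} (θ : Fin k → α)
    (p : Fin (k + 1)) (e : Equiv.Perm (Fin k)) :
    Integrable (fun t => ∏ i, projKernel φ
        ((Fin.cons t θ : Fin (k + 1) → α) (Equiv.Perm.decomposeFin.symm (p, e) i))
        ((Fin.cons t θ : Fin (k + 1) → α) i)) μ ∧
      ∫ t, ∏ i, projKernel φ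
        ((Fin.cons t θ : Fin (k + 1) → α) (Equiv.Perm.decomposeFin.symm (p, e) i))
        ((Fin.cons t θ : Fin (k + 1) → α) i) ∂μ =
      (if p = 0 then (N : ℝ) else 1) * ∏ i, projKernel φ (θ (e i)) (θ i) := by
  simp only [Fin.prod_univ_succ, Equiv.Perm.decomposeFin_symm_apply_zero,
    Equiv.Perm.decomposeFin_symm_apply_succ, Fin.cons_zero, Fin.cons_succ]
  induction p using Fin.cases with
  | zero =>
    simp only [Equiv.swap_self, Equiv.refl_apply, Fin.cons_zero, Fin.cons_succ, if_true]
    refine ⟨h.integral_projKernel_self.1.mul_const _, ?_⟩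
    rw [integral_mul_const, h.integral_projKernel_self.2]
  | succ q =>
    have h1 : ∀ t, projKernel φ ((Fin.cons t θ : Fin (k + 1) → α) q.succ) t *
        ∏ i, projKernel φ
          ((Fin.cons t θ : Fin (k + 1) → α) (Equiv.swap 0 q.succ (e i).succ)) (θ i) =
        projKernel φ (θ q) t * projKernel φ t (θ (e.symm q)) *
          ∏ i ∈ univ.erase (e.symm q), projKernel φ (θ (e i)) (θ i) := by
      intro t
      rw [← mul_prod_erase univ _ (mem_univ (e.symm q)), Fin.cons_succ, Equiv.apply_symm_apply,
        Equiv.swap_apply_right, Fin.cons_zero, mul_assoc]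
      congr 2
      refine prod_congr rfl fun i hi => ?_
      have : e i ≠ q := fun hq => (mem_erase.1 hi).1 (by rw [← hq, Equiv.symm_apply_apply])
      rw [Equiv.swap_apply_of_ne_of_ne (Fin.succ_ne_zero _) ((Fin.succ_injective k).ne this),
        Fin.cons_succ]
    simp only [h1, Fin.succ_ne_zero, if_false, one_mul]
    refine ⟨(h.integral_projKernel_mul _ _).1.mul_const _, ?_⟩
    rw [integral_mul_const, (h.integral_projKernel_mul _ _).2,
      ← mul_prod_erase univ _ (mem_univ (e.symm q)), Equiv.apply_symm_apply]

lemma IsOrthonormal.integral_projDet_cons (h : IsOrthonormal μ φ) {k : ℕ} (θ : Fin k → α) :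
    Integrable (fun t => projDet φ (k + 1) (Fin.cons t θ : Fin (k + 1) → α)) μ ∧
      ∫ t, projDet φ (k + 1) (Fin.cons t θ : Fin (k + 1) → α) ∂μ =
        (N - k) * projDet φ k θ := by
  simp only [projDet, Matrix.det_apply', Matrix.of_apply]
  have hi : ∀ σ : Equiv.Perm (Fin (k + 1)), Integrable (fun t =>
      ((Equiv.Perm.sign σ : ℤ) : ℝ) * ∏ i, projKernel φ
        ((Fin.cons t θ : Fin (k + 1) → α) (σ i)) ((Fin.cons t θ : Fin (k + 1) → α) i)) μ := by
    intro σ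
    have := (h.integral_prod_decomposeFin θ (Equiv.Perm.decomposeFin σ).1
      (Equiv.Perm.decomposeFin σ).2).1
    rw [Prod.mk.eta, Equiv.symm_apply_apply] at this
    exact this.const_mul _
  refine ⟨integrable_finsetSum _ fun σ _ => hi σ, ?_⟩
  -- The choice `p = 0` contributes `N`; each of the other `k` choices contributes `-1`, the sign of
  -- the transposition.
  rw [integral_finsetSum _ fun σ _ => hi σ, ← Equiv.sum_comp Equiv.Perm.decomposeFin.symm,
    Fintype.sum_prod_type, Fin.sum_univ_succ]
  simp only [integral_const_mul, (h.integral_prod_decomposeFin θ _ _).2,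
    Equiv.Perm.decomposeFin.symm_sign, Fin.succ_ne_zero, if_true, if_false]
  rw [sum_const, card_univ, Fintype.card_fin, sub_mul, mul_sum, nsmul_eq_mul, mul_sum, mul_sum,
    sub_eq_add_neg, ← sum_neg_distrib]
  congr 1 <;> refine sum_congr rfl fun σ _ => ?_ <;> push_cast <;> ring

variable [SigmaFinite μ]

lemma IsOrthonormal.integral_mul_projDet_cons (h : IsOrthonormal μ φ)
    (hφ : ∀ i, Measurable (φ i)) {k : ℕ} (hk : k < N) {g : (Fin k → α) → ℝ}
    (hg : Integrable (fun θ => g θ * projDet φ k θ) (Measure.pi fun _ => μ)) :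
    Integrable (fun z : α × (Fin k → α) =>
        g z.2 * projDet φ (k + 1) (Fin.cons z.1 z.2 : Fin (k + 1) → α))
        (μ.prod (Measure.pi fun _ => μ)) ∧
      ∫ z : α × (Fin k → α), g z.2 * projDet φ (k + 1) (Fin.cons z.1 z.2 : Fin (k + 1) → α)
          ∂(μ.prod (Measure.pi fun _ => μ)) =
        (N - k) * ∫ θ, g θ * projDet φ k θ ∂(Measure.pi fun _ => μ) := by
  have hNk : (0 : ℝ) ≤ N - k := sub_nonneg.2 (by exact_mod_cast hk.le)
  have hmeas : AEStronglyMeasurable (fun z : α × (Fin k → α) =>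
      g z.2 * projDet φ (k + 1) (Fin.cons z.1 z.2 : Fin (k + 1) → α))
      (μ.prod (Measure.pi fun _ => μ)) := by
    have hcons : Measurable fun z : α × (Fin k → α) => (Fin.cons z.1 z.2 : Fin (k + 1) → α) :=
      measurable_pi_iff.2 <| Fin.cases (by simpa using measurable_fst) fun i => by
        simpa using! (measurable_pi_apply i).comp measurable_snd
    -- Only the product `g * projDet φ k` is known to be measurable, so the integrand is written as
    -- this product times a quotient of determinants; where the denominator vanishes, so does the
    -- numerator.
    have h1 : Measurable fun z : α × (Fin k → α) =>
        projDet φ (k + 1) (Fin.cons z.1 z.2 : Fin (k + 1) → α) / projDet φ k z.2 :=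
      ((measurable_projDet hφ (k + 1)).comp hcons).div
        ((measurable_projDet hφ k).comp measurable_snd)
    refine (hg.aestronglyMeasurable.comp_snd.mul h1.aestronglyMeasurable).congr
      (Eventually.of_forall fun z => ?_)
    by_cases h0 : projDet φ k z.2 = 0
    · simp [h0, projDet_cons_eq_zero φ h0]
    · simp only [Pi.mul_apply]
      field_simp
  have hint : Integrable (fun z : α × (Fin k → α) =>
      g z.2 * projDet φ (k + 1) (Fin.cons z.1 z.2 : Fin (k + 1) → α))
      (μ.prod (Measure.pi fun _ => μ)) := by
    rw [integrable_prod_iff' hmeas]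
    refine ⟨Eventually.of_forall fun θ => (h.integral_projDet_cons θ).1.const_mul (g θ), ?_⟩
    -- As determinants are nonnegative, the inner integral of the norm is exact.
    refine (hg.norm.const_mul ((N : ℝ) - k)).congr (Eventually.of_forall fun θ => ?_)
    simp only [norm_mul, Real.norm_of_nonneg (projDet_nonneg φ _ _), integral_const_mul,
      (h.integral_projDet_cons θ).2]
    ring
  refine ⟨hint, ?_⟩
  rw [integral_prod_symm _ hint, ← integral_const_mul]
  refine integral_congr_ae (Eventually.of_forall fun θ => ?_)
  simp only [integral_const_mul, (h.integral_projDet_cons θ).2]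
  ring

/-- Integrating out all variables but those selected by the injection `J`. -/
theorem IsOrthonormal.integral_comp_mul_projDet (h : IsOrthonormal μ φ)
    (hφ : ∀ i, Measurable (φ i)) {m : ℕ} {f : (Fin m → α) → ℝ}
    (hf : Integrable (fun θ => f θ * projDet φ m θ) (Measure.pi fun _ => μ)) {k : ℕ} (hk : k ≤ N)
    {J : Fin m → Fin k} (hJ : Function.Injective J) :
    Integrable (fun θ => f (θ ∘ J) * projDet φ k θ) (Measure.pi fun _ => μ) ∧
      (N - k).factorial * ∫ θ, f (θ ∘ J) * projDet φ k θ ∂(Measure.pi fun _ => μ) =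
        (N - m).factorial * ∫ θ, f θ * projDet φ m θ ∂(Measure.pi fun _ => μ) := by
  -- When `J` is bijective nothing is integrated out: the variables are only relabelled, and the
  -- determinant is symmetric.
  have hbij : ∀ {k : ℕ} {J : Fin m → Fin k}, Function.Bijective J →
      Integrable (fun θ => f (θ ∘ J) * projDet φ k θ) (Measure.pi fun _ => μ) ∧
      (N - k).factorial * ∫ θ, f (θ ∘ J) * projDet φ k θ ∂(Measure.pi fun _ => μ) =
        (N - m).factorial * ∫ θ, f θ * projDet φ m θ ∂(Measure.pi fun _ => μ) := by
    intro k J hJ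
    have hmk : m = k := by simpa using Fintype.card_of_bijective hJ
    subst hmk
    let e := Equiv.ofBijective J hJ
    have he := measurePreserving_piCongrLeft (α := fun _ => α) (fun _ => μ) e.symm
    have hc : ∀ θ, MeasurableEquiv.piCongrLeft (fun _ : Fin m => α) e.symm θ = θ ∘ J := by
      intro θ
      funext i
      have := MeasurableEquiv.piCongrLeft_apply_apply (β := fun _ : Fin m => α) e.symm θ (e i)
      rw [Equiv.symm_apply_apply] at this
      exact this
    have hD : ∀ θ, f (θ ∘ J) * projDet φ m θ =
        (fun θ => f θ * projDet φ m θ)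
          (MeasurableEquiv.piCongrLeft (fun _ : Fin m => α) e.symm θ) := by
      intro θ
      rw [hc]
      exact congrArg _ (projDet_comp_equiv φ θ e).symm
    simp only [hD]
    exact ⟨(he.integrable_comp_emb (MeasurableEquiv.measurableEmbedding _)).2 hf,
      congrArg _ (he.integral_comp' (fun θ => f θ * projDet φ m θ))⟩
  induction k with
  | zero => exact hbij ⟨hJ, fun i => i.elim0⟩
  | succ k ih =>
    by_cases hs : Function.Surjective J
    · exact hbij ⟨hJ, hs⟩
    · obtain ⟨p, hp⟩ := not_forall.1 hs
      have hp' : ∀ i, ∃ z, p.succAbove z = J i := fun i =>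
        Fin.exists_succAbove_eq fun hi => hp ⟨i, hi⟩
      choose J' hJ' using hp'
      have hJ'i : Function.Injective J' := fun a b hab => hJ (by rw [← hJ', ← hJ', hab])
      obtain ⟨h1, h2⟩ := ih (by omega) hJ'i
      obtain ⟨h3, h4⟩ := h.integral_mul_projDet_cons hφ (by omega) h1
      have he := measurePreserving_piFinSuccAbove (α := fun _ => α) (fun _ => μ) p
      have hD : ∀ θ, f (θ ∘ J) * projDet φ (k + 1) θ =
          (fun z : α × (Fin k → α) =>
            f (z.2 ∘ J') * projDet φ (k + 1) (Fin.cons z.1 z.2 : Fin (k + 1) → α))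
              (MeasurableEquiv.piFinSuccAbove (fun _ => α) p θ) := by
        intro θ
        have e1 : θ ∘ J = (p.removeNth θ) ∘ J' := by
          funext i
          simp only [Function.comp_apply, ← hJ', Fin.removeNth]
        rw [← projDet_cons_removeNth φ p θ, e1]
        rfl
      simp only [hD]
      refine ⟨(he.integrable_comp_emb (MeasurableEquiv.measurableEmbedding _)).2 h3, ?_⟩
      rw [he.integral_comp' (fun z : α × (Fin k → α) =>
            f (z.2 ∘ J') * projDet φ (k + 1) (Fin.cons z.1 z.2 : Fin (k + 1) → α)), h4, ← h2]
      have : N - k = (N - (k + 1)) + 1 := by omega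
      rw [this, Nat.factorial_succ, ← this, Nat.cast_mul, Nat.cast_sub (by omega)]
      ring

lemma IsOrthonormal.integral_projDet_self (h : IsOrthonormal μ φ) (hφ : ∀ i, Measurable (φ i)) :
    ∫ θ, projDet φ N θ ∂(Measure.pi fun _ => μ) = N.factorial := by
  have h0 : ∀ θ : Fin 0 → α, projDet φ 0 θ = 1 := fun θ => Matrix.det_isEmpty
  have : IsProbabilityMeasure (Measure.pi fun _ : Fin 0 => μ) := ⟨by simp⟩
  have h1 : Integrable (fun θ : Fin 0 → α => (1 : ℝ) * projDet φ 0 θ)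
      (Measure.pi fun _ => μ) := by
    simp only [h0]
    exact integrable_const _
  -- The case `m = 0`, `f = 1`: all variables are integrated out.
  have h2 := (h.integral_comp_mul_projDet hφ h1 le_rfl
    (J := Fin.elim0) (fun i => i.elim0)).2
  simpa [h0] using h2

end Determinantal

/-! ### The level densities of the eigenangles. -/

lemma card_orderEmbedding_fin (m M : ℕ) : Fintype.card (Fin m ↪o Fin M) = M.choose m := by
  rw [← Nat.card_eq_fintype_card, Nat.card_congr Set.powersetCard.ofFinEmbEquiv,
    Set.powersetCard.card, Nat.card_eq_fintype_card, Fintype.card_fin]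

lemma two_mul_sin_half_sq (θ : ℝ) : 2 * Real.sin (θ / 2) ^ 2 = 1 - Real.cos θ := by
  rw [Real.sin_sq_eq_half_sub, mul_div_cancel₀ θ two_ne_zero]
  ring

lemma two_pow_mul_sin_half_pow (n : ℕ) (θ : ℝ) :
    2 ^ n * Real.sin (θ / 2) ^ n * Real.sin (θ / 2) ^ n = (1 - Real.cos θ) ^ n := by
  rw [← two_mul_sin_half_sq, ← mul_pow, ← mul_pow]
  ring

lemma kernelDet_eq_det_mul_prod (n M m : ℕ) (θ : Fin m → ℝ) :
    kernelDet n M m θ =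
      (Matrix.of fun j k : Fin m => jacobiKernel n M (θ j) (θ k)).det *
        ∏ j, (1 - Real.cos (θ j)) ^ n := by
  have h : (Matrix.of fun j k : Fin m => weightedKernel n M (θ j) (θ k)) =
      Matrix.of fun j k => 2 ^ n * Real.sin (θ j / 2) ^ n *
        (Matrix.of fun j k => Real.sin (θ k / 2) ^ n *
          (Matrix.of fun j k : Fin m => jacobiKernel n M (θ j) (θ k)) j k) j k := by
    ext j k
    simp only [Matrix.of_apply, weightedKernel]
    ring
  rw [kernelDet, h, Matrix.det_mul_column, Matrix.det_mul_row, ← mul_assoc, ← prod_mul_distrib,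
    mul_comm]
  simp only [two_pow_mul_sin_half_pow]

/-- The orthonormal functions whose projection kernel is `weightedKernel`. -/
def jacobiFun (n M : ℕ) (i : Fin M) (θ : ℝ) : ℝ :=
  √(jacobiInvNorm n i) * (√2 ^ n * Real.sin (θ / 2) ^ n) *
    (jacobiPoly n i).eval ((1 - Real.cos θ) / 2)

lemma jacobiFun_mul_jacobiFun (n M : ℕ) (i j : Fin M) (θ φ : ℝ) :
    jacobiFun n M i θ * jacobiFun n M j φ = √(jacobiInvNorm n i) * √(jacobiInvNorm n j) *
      (2 ^ n * Real.sin (θ / 2) ^ n * Real.sin (φ / 2) ^ n) *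
        ((jacobiPoly n i).eval ((1 - Real.cos θ) / 2) *
          (jacobiPoly n j).eval ((1 - Real.cos φ) / 2)) := by
  have h2 : √2 ^ n * √2 ^ n = (2 : ℝ) ^ n := by
    rw [← mul_pow, Real.mul_self_sqrt zero_le_two]
  rw [jacobiFun, jacobiFun, ← h2]
  ring

lemma continuous_jacobiFun (n M : ℕ) (i : Fin M) : Continuous (jacobiFun n M i) := by
  have : Continuous fun θ : ℝ => (jacobiPoly n i).eval ((1 - Real.cos θ) / 2) :=
    (jacobiPoly n i).continuous.comp (by fun_prop)
  unfold jacobiFun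
  fun_prop

lemma projKernel_jacobiFun (n M : ℕ) (θ φ : ℝ) :
    projKernel (jacobiFun n M) θ φ = weightedKernel n M θ φ := by
  rw [projKernel, weightedKernel, jacobiKernel_eq, mul_sum, ← Fin.sum_univ_eq_sum_range
    (fun j => 2 ^ n * Real.sin (θ / 2) ^ n * Real.sin (φ / 2) ^ n * (jacobiInvNorm n j *
      (jacobiPoly n j).eval ((1 - Real.cos θ) / 2) *
        (jacobiPoly n j).eval ((1 - Real.cos φ) / 2)))]
  refine sum_congr rfl fun i _ => ?_
  rw [jacobiFun_mul_jacobiFun, Real.mul_self_sqrt (jacobiInvNorm_pos n i).le]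
  ring

lemma projDet_jacobiFun (n M m : ℕ) (θ : Fin m → ℝ) :
    projDet (jacobiFun n M) m θ = kernelDet n M m θ := by
  simp only [projDet, kernelDet, projKernel_jacobiFun]

lemma isOrthonormal_jacobiFun (n M : ℕ) :
    IsOrthonormal (volume.restrict (Set.Icc 0 Real.pi)) (jacobiFun n M) := by
  intro i j
  refine ⟨(((continuous_jacobiFun n M i).mul (continuous_jacobiFun n M j)).continuousOn
    |>.integrableOn_compact isCompact_Icc), ?_⟩
  have h : ∀ θ, jacobiFun n M i θ * jacobiFun n M j θ =
      √(jacobiInvNorm n i) * √(jacobiInvNorm n j) *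
        ((jacobiPoly n i * jacobiPoly n j).eval ((1 - Real.cos θ) / 2) *
          (1 - Real.cos θ) ^ n) := by
    intro θ
    rw [jacobiFun_mul_jacobiFun, two_pow_mul_sin_half_pow, eval_mul]
    ring
  simp only [h]
  rw [integral_const_mul, integral_Icc_eq_integral_Ioc,
    ← intervalIntegral.integral_of_le Real.pi_pos.le, ← weightIntegral_apply,
    weightIntegral_jacobiPoly]
  by_cases hij : i = j
  · subst hij
    rw [if_pos rfl, if_pos rfl, Real.mul_self_sqrt (jacobiInvNorm_pos n i).le,
      mul_inv_cancel₀ (jacobiInvNorm_pos n i).ne']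
  · rw [if_neg hij, if_neg (fun h => hij (Fin.ext h)), mul_zero]

/-- Divided by their leading coefficients, the polynomials are monic of degrees `0, …, M - 1`, which
gives a Vandermonde determinant. -/
lemma det_eval_jacobiPoly (n : ℕ) {M : ℕ} (s : Fin M → ℝ) :
    (Matrix.of fun i l : Fin M => (jacobiPoly n l).eval (s i)).det =
      (∏ l : Fin M, jacobiCoeff n l l) * ∏ i, ∏ j ∈ Ioi i, (s j - s i) := by
  have h0 := fun l : ℕ => jacobiCoeff_self_ne_zero n l
  rw [← Matrix.det_vandermonde, Matrix.det_eval_matrixOfPolynomials_eq_det_vandermonde s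
    (fun l : Fin M => C (jacobiCoeff n l l)⁻¹ * jacobiPoly n l), ← Matrix.det_mul_row]
  · congr 1
    ext i l
    simp only [Matrix.of_apply, eval_mul, eval_C]
    rw [mul_inv_cancel_left₀ (h0 l)]
  · intro l
    rw [natDegree_C_mul (inv_ne_zero (h0 l)), natDegree_jacobiPoly]
  · intro l
    rw [Monic, leadingCoeff_mul, leadingCoeff_C, leadingCoeff, natDegree_jacobiPoly,
      coeff_jacobiPoly, inv_mul_cancel₀ (h0 l)]

lemma exists_projDet_jacobiFun_eq (n M : ℕ) : ∃ c : ℝ, c ≠ 0 ∧ ∀ θ : Fin M → ℝ,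
    projDet (jacobiFun n M) M θ = c * jointWeight n M θ := by
  -- The factors come from the normalisation, the leading coefficients, and `s_j - s_i = (cos θ_i -
  -- cos θ_j) / 2`. Only `c ≠ 0` matters later, since `c` cancels against `normConst`.
  refine ⟨(∏ l : Fin M, √(jacobiInvNorm n l)) ^ 2 * (∏ l : Fin M, jacobiCoeff n l l) ^ 2 *
    (∏ i : Fin M, ∏ _j ∈ Ioi i, (1 / 2 : ℝ)) ^ 2, ?_, fun θ => ?_⟩
  · refine mul_ne_zero (mul_ne_zero ?_ ?_) ?_ <;> refine pow_ne_zero 2 ?_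
    · exact prod_ne_zero_iff.2 fun l _ => (Real.sqrt_pos.2 (jacobiInvNorm_pos n l)).ne'
    · exact prod_ne_zero_iff.2 fun l _ => jacobiCoeff_self_ne_zero n l
    · exact prod_ne_zero_iff.2 fun i _ => prod_ne_zero_iff.2 fun j _ => by norm_num
  · have h1 : (Matrix.of fun i l => jacobiFun n M l (θ i)) =
        Matrix.of fun i l => (√2 ^ n * Real.sin (θ i / 2) ^ n) *
          (Matrix.of fun i l : Fin M => √(jacobiInvNorm n l) *
            (Matrix.of fun i l : Fin M =>
              (jacobiPoly n l).eval ((1 - Real.cos (θ i)) / 2)) i l) i l := by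
      ext i l
      simp only [Matrix.of_apply, jacobiFun]
      ring
    have h2 : ∀ i j, (1 - Real.cos (θ j)) / 2 - (1 - Real.cos (θ i)) / 2 =
        1 / 2 * (Real.cos (θ i) - Real.cos (θ j)) := fun i j => by ring
    have h3 : (∏ i, (√2 ^ n * Real.sin (θ i / 2) ^ n)) ^ 2 =
        ∏ i, (1 - Real.cos (θ i)) ^ n := by
      rw [← prod_pow]
      refine prod_congr rfl fun i _ => ?_
      rw [← two_mul_sin_half_sq, ← mul_pow, ← pow_mul, mul_comm n 2, pow_mul, mul_pow,
        Real.sq_sqrt zero_le_two]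
    rw [projDet_self, h1, Matrix.det_mul_column, Matrix.det_mul_row, det_eval_jacobiPoly,
      jointWeight, ← h3]
    simp only [h2, prod_mul_distrib, prod_pow]
    ring

lemma volume_restrict_angleBox (m : ℕ) : (volume : Measure (Fin m → ℝ)).restrict (angleBox m) =
    Measure.pi fun _ => volume.restrict (Set.Icc 0 Real.pi) := by
  rw [angleBox, volume_pi, Measure.restrict_pi_pi]

theorem isLevelDensity_kernelDet (n M m : ℕ) : IsLevelDensity n M m (kernelDet n M m) := by
  intro f hf
  have hφ := isOrthonormal_jacobiFun n M
  have hφm := fun i => (continuous_jacobiFun n M i).measurable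
  obtain ⟨c, hc, hw⟩ := exists_projDet_jacobiFun_eq n M
  have hw' : ∀ θ, jointWeight n M θ = c⁻¹ * projDet (jacobiFun n M) M θ := fun θ => by
    rw [hw, inv_mul_cancel_left₀ hc]
  simp only [← projDet_jacobiFun, IntegrableOn, volume_restrict_angleBox] at hf ⊢
  have hnorm : normConst n M = c / M.factorial := by
    simp only [normConst, volume_restrict_angleBox, hw']
    rw [integral_const_mul, hφ.integral_projDet_self hφm, mul_inv, inv_inv, div_eq_mul_inv]
  have hJ := fun J : Fin m ↪o Fin M =>
    hφ.integral_comp_mul_projDet hφm hf le_rfl J.injective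
  have hsum : ∀ θ, levelSum f θ * jointWeight n M θ =
      c⁻¹ * ∑ J : Fin m ↪o Fin M, f (θ ∘ J) * projDet (jacobiFun n M) M θ := by
    intro θ
    rw [hw', levelSum, ← sum_mul]
    simp only [Function.comp_def]
    ring
  simp only [hsum]
  refine ⟨(integrable_finsetSum _ fun J _ => (hJ J).1).const_mul _, ?_⟩
  rw [integral_const_mul, integral_finsetSum _ fun J _ => (hJ J).1, hnorm]
  -- For `m ≤ M` the constants combine to `choose(M, m) (M - m)! / M! = 1 / m!`. For `m > M` the sum
  -- is empty and the determinant vanishes by rank.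
  rcases le_or_gt m M with hmM | hmM
  · have h2 := fun J => (hJ J).2
    simp only [Nat.sub_self, Nat.factorial_zero, Nat.cast_one, one_mul] at h2
    simp only [h2]
    rw [sum_const, card_univ, card_orderEmbedding_fin, nsmul_eq_mul,
      ← Nat.choose_mul_factorial_mul_factorial hmM]
    have h3 : ((M.choose m : ℕ) : ℝ) ≠ 0 := by exact_mod_cast (Nat.choose_pos hmM).ne'
    push_cast
    field_simp
  · have : IsEmpty (Fin m ↪o Fin M) := by
      rw [← Fintype.card_eq_zero_iff, card_orderEmbedding_fin, Nat.choose_eq_zero_of_lt hmM]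
    simp [projDet_eq_zero_of_lt _ hmM]

/-! ### Bessel functions of half-integer order. -/

lemma halfPoch_add_ge (n k : ℕ) : halfPoch n * (1 / 2) ^ k ≤ halfPoch (n + k) := by
  induction k with
  | zero => simp
  | succ k ih =>
    rw [← add_assoc, halfPoch_succ, pow_succ, ← mul_assoc]
    have := halfPoch_pos n
    have h : (1 / 2 : ℝ) ≤ ((n + k : ℕ) : ℝ) + 1 / 2 := le_add_of_nonneg_left (Nat.cast_nonneg _)
    exact mul_le_mul ih h (by norm_num) (halfPoch_pos _).le

lemma pow_div_factorial_mul_halfPoch_le {x : ℝ} (hx : 0 ≤ x) (n k : ℕ) :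
    x ^ k / (k.factorial * halfPoch (n + k)) ≤
      (halfPoch n)⁻¹ * ((2 * x) ^ k / k.factorial) := by
  have h0 := halfPoch_pos n
  have h1 := halfPoch_add_ge n k
  have h2 : 0 < halfPoch n * (1 / 2) ^ k := by positivity
  calc x ^ k / (k.factorial * halfPoch (n + k))
      ≤ x ^ k / (k.factorial * (halfPoch n * (1 / 2) ^ k)) := by gcongr
    _ = _ := by rw [mul_pow, one_div_pow]; field_simp

/-- The terms of the entire function `besselSeries`. -/
def besselTerm (n : ℕ) (x : ℝ) (k : ℕ) : ℝ := (-x) ^ k / (k.factorial * halfPoch (n + k))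

/-- The entire function `∑ (-x)^k / (k! (1/2)_{n+k})`. -/
def besselSeries (n : ℕ) (x : ℝ) : ℝ := ∑' k, besselTerm n x k

lemma norm_besselTerm_le (n : ℕ) (x : ℝ) (k : ℕ) :
    ‖besselTerm n x k‖ ≤ (halfPoch n)⁻¹ * ((2 * |x|) ^ k / k.factorial) := by
  rw [besselTerm, norm_div, norm_pow, norm_neg, Real.norm_eq_abs,
    Real.norm_of_nonneg (mul_nonneg (Nat.cast_nonneg _) (halfPoch_pos _).le)]
  exact pow_div_factorial_mul_halfPoch_le (abs_nonneg x) n k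

lemma summable_besselTerm (n : ℕ) (x : ℝ) : Summable (besselTerm n x) :=
  Summable.of_norm_bounded ((Real.summable_pow_div_factorial _).mul_left _)
    (norm_besselTerm_le n x)

lemma succ_mul_besselTerm_succ (n : ℕ) (x : ℝ) (k : ℕ) :
    ((k + 1 : ℕ) : ℝ) * besselTerm n x (k + 1) = -x * besselTerm (n + 1) x k := by
  rw [besselTerm, besselTerm, Nat.factorial_succ, pow_succ, show n + (k + 1) = n + 1 + k by ring]
  have := halfPoch_ne_zero (n + 1 + k)
  push_cast
  field_simp

lemma hasSum_mul_besselTerm (n : ℕ) (x : ℝ) :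
    HasSum (fun k : ℕ => (k : ℝ) * besselTerm n x k) (-x * besselSeries (n + 1) x) := by
  have h := (summable_besselTerm (n + 1) x).hasSum.mul_left (-x)
  simp only [← succ_mul_besselTerm_succ] at h
  rw [hasSum_nat_add_iff (f := fun k : ℕ => (k : ℝ) * besselTerm n x k) 1] at h
  simpa using! h

/-- Termwise, the factor `n + k + 1/2` lowers `(1/2)_{n+k+1}` to `(1/2)_{n+k}`; its part `k` acts as
`x d/dx`. -/
lemma besselSeries_recurrence (n : ℕ) (x : ℝ) :
    besselSeries n x = (n + 1 / 2) * besselSeries (n + 1) x - x * besselSeries (n + 2) x := by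
  have h := ((summable_besselTerm (n + 1) x).hasSum.mul_left ((n : ℝ) + 1 / 2)).add
    (hasSum_mul_besselTerm (n + 1) x)
  have h1 : ∀ k : ℕ, ((n : ℝ) + 1 / 2) * besselTerm (n + 1) x k + k * besselTerm (n + 1) x k =
      besselTerm n x k := by
    intro k
    rw [besselTerm, besselTerm, show n + 1 + k = n + k + 1 by ring, halfPoch_succ]
    have := halfPoch_ne_zero (n + k)
    have : (n : ℝ) + k + 1 / 2 ≠ 0 := by positivity
    push_cast
    field_simp
    ring
  simp only [h1] at h
  rw [besselSeries, h.tsum_eq, besselSeries, besselSeries]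
  ring

lemma hasDerivAt_besselSeries (n : ℕ) (x : ℝ) :
    HasDerivAt (besselSeries n) (-besselSeries (n + 1) x) x := by
  set R := |x| + 1 with hR
  have hR0 : 0 < R := by positivity
  have hd : ∀ (k : ℕ) (y : ℝ), HasDerivAt (fun y => besselTerm n y k)
      (-(k * (-y) ^ (k - 1)) / (k.factorial * halfPoch (n + k))) y := by
    intro k y
    have := ((hasDerivAt_neg y).pow k).div_const (k.factorial * halfPoch (n + k))
    exact this.congr_deriv (by ring)
  have hs : ∀ (y : ℝ) (k : ℕ),
      -(((k + 1 : ℕ) : ℝ) * (-y) ^ (k + 1 - 1)) / ((k + 1).factorial * halfPoch (n + (k + 1))) =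
        -besselTerm (n + 1) y k := by
    intro y k
    rw [besselTerm, Nat.factorial_succ, show n + (k + 1) = n + 1 + k by ring,
      Nat.add_sub_cancel]
    have := halfPoch_ne_zero (n + 1 + k)
    push_cast
    field_simp
  have hsum : HasSum (fun k : ℕ => -(k * (-x) ^ (k - 1)) / (k.factorial * halfPoch (n + k)))
      (-besselSeries (n + 1) x) := by
    have h := (summable_besselTerm (n + 1) x).hasSum.neg
    simp only [← hs] at h
    rw [hasSum_nat_add_iff
      (f := fun k : ℕ => -(k * (-x) ^ (k - 1)) / (k.factorial * halfPoch (n + k))) 1] at h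
    simpa using! h
  have hu : Summable fun k : ℕ => k * R ^ (k - 1) / (k.factorial * halfPoch (n + k)) := by
    rw [← summable_nat_add_iff 1]
    -- At `-R` all terms are positive, so this series is itself the majorant on the ball.
    have h := (summable_besselTerm (n + 1) (-R))
    refine h.congr fun k => ?_
    have := hs (-R) k
    rw [neg_neg] at this
    rw [eq_comm, ← neg_inj, ← this]
    ring
  rw [← hsum.tsum_eq]
  refine hasDerivAt_tsum_of_isPreconnected hu Metric.isOpen_ball
    (convex_ball (0 : ℝ) R).isPreconnected (fun k y _ => hd k y) (fun k y hy => ?_)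
    (Metric.mem_ball_self hR0) (summable_besselTerm n 0) (by simp [hR])
  have hy : |y| ≤ R := by simpa using (Metric.mem_ball.1 hy).le
  have hp : 0 < (k.factorial : ℝ) * halfPoch (n + k) :=
    mul_pos (by positivity) (halfPoch_pos _)
  rw [norm_div, norm_neg, norm_mul, norm_pow, norm_neg, Real.norm_of_nonneg hp.le,
    Real.norm_natCast, Real.norm_eq_abs]
  gcongr

lemma continuous_besselSeries (n : ℕ) : Continuous (besselSeries n) :=
  continuous_iff_continuousAt.2 fun x => (hasDerivAt_besselSeries n x).continuousAt

lemma besselSeries_zero_right (n : ℕ) : besselSeries n 0 = (halfPoch n)⁻¹ := by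
  rw [besselSeries, tsum_eq_single 0 fun k hk => by simp [besselTerm, hk]]
  simp [besselTerm]

/-- The function `√(π z / 2) J_{n-1/2}(z)`, as an entire function of `z`. -/
def riccatiBessel (n : ℕ) (z : ℝ) : ℝ := (z / 2) ^ n * besselSeries n ((z / 2) ^ 2)

lemma continuous_riccatiBessel (n : ℕ) : Continuous (riccatiBessel n) := by
  have := continuous_besselSeries n
  unfold riccatiBessel
  fun_prop

lemma riccatiBessel_succ_zero (n : ℕ) : riccatiBessel (n + 1) 0 = 0 := by
  simp [riccatiBessel]

lemma hasDerivAt_riccatiBessel (n : ℕ) {z : ℝ} (hz : z ≠ 0) :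
    HasDerivAt (riccatiBessel n) (n / z * riccatiBessel n z - riccatiBessel (n + 1) z) z := by
  have h1 : HasDerivAt (fun z : ℝ => z / 2) (1 / 2) z := (hasDerivAt_id z).div_const 2
  have h2 := (h1.pow n).mul ((hasDerivAt_besselSeries n ((z / 2) ^ 2)).comp z (h1.pow 2))
  refine h2.congr_deriv ?_
  rcases n with _ | n
  · simp [riccatiBessel]
    ring
  · simp only [riccatiBessel, Nat.add_sub_cancel, Pi.pow_apply, Function.comp_apply]
    rw [pow_succ, pow_succ (z / 2) (n + 1), pow_succ]
    push_cast
    field_simp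
    ring

lemma riccatiBessel_recurrence (n : ℕ) {z : ℝ} (hz : z ≠ 0) :
    riccatiBessel (n + 2) z = (2 * n + 1) / z * riccatiBessel (n + 1) z - riccatiBessel n z := by
  rw [riccatiBessel, riccatiBessel, riccatiBessel, besselSeries_recurrence n]
  rw [pow_succ (z / 2) (n + 1), pow_succ (z / 2) n]
  field_simp
  ring

lemma hasDerivAt_riccatiBessel_succ (n : ℕ) {z : ℝ} (hz : z ≠ 0) :
    HasDerivAt (riccatiBessel (n + 1))
      (riccatiBessel n z - n / z * riccatiBessel (n + 1) z) z := by
  refine (hasDerivAt_riccatiBessel (n + 1) hz).congr_deriv ?_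
  rw [riccatiBessel_recurrence n hz]
  push_cast
  field_simp
  ring

lemma besselJ_sub_half (n : ℕ) {z : ℝ} (hz : 0 < z) :
    besselJ (n - 1 / 2) z = riccatiBessel n z / (√(z / 2) * √Real.pi) := by
  have hz2 : 0 < z / 2 := by positivity
  have h1 : ∀ k : ℕ, (-1 : ℝ) ^ k / ((k.factorial : ℝ) * Real.Gamma (n - 1 / 2 + k + 1)) *
      (z / 2) ^ (2 * k) = besselTerm n ((z / 2) ^ 2) k / √Real.pi := by
    intro k
    rw [show (n : ℝ) - 1 / 2 + k + 1 = ((n + k : ℕ) : ℝ) + 1 / 2 by push_cast; ring,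
      Gamma_nat_add_half', besselTerm, pow_mul, neg_pow ((z / 2) ^ 2)]
    have := halfPoch_ne_zero (n + k)
    field_simp
  rw [besselJ, tsum_congr h1, tsum_div_const, Real.rpow_sub hz2, Real.rpow_natCast,
    ← Real.sqrt_eq_rpow, riccatiBessel, besselSeries]
  field_simp

/-- This is `J_{ν-1} = (2 ν / z) J_ν - J_{ν+1}` with `ν = n - 1/2`. The indices `n` and `n + 1` on
the right include `n = 0`, where the order is `-3/2`. -/
lemma besselJ_sub_three_halves (n : ℕ) {z : ℝ} (hz : 0 < z) :
    besselJ (n - 3 / 2) z = ((2 * n - 1) / z * riccatiBessel n z - riccatiBessel (n + 1) z) /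
      (√(z / 2) * √Real.pi) := by
  have hz2 : 0 < z / 2 := by positivity
  have h1 : ∀ k : ℕ, (-1 : ℝ) ^ k / ((k.factorial : ℝ) * Real.Gamma (n - 3 / 2 + k + 1)) *
      (z / 2) ^ (2 * k) = ((n - 1 / 2) * besselTerm n ((z / 2) ^ 2) k +
        k * besselTerm n ((z / 2) ^ 2) k) / √Real.pi := by
    intro k
    -- By parity; hence the Gamma recursion applies even at `-1/2`.
    have h0 : (n : ℝ) + k - 1 / 2 ≠ 0 := by
      intro h
      have h2 : ((2 * (n + k) : ℕ) : ℝ) = ((1 : ℕ) : ℝ) := by push_cast; linarith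
      have := Nat.cast_injective h2
      omega
    have h2 := Real.Gamma_add_one h0
    rw [show (n : ℝ) + k - 1 / 2 + 1 = ((n + k : ℕ) : ℝ) + 1 / 2 by push_cast; ring,
      Gamma_nat_add_half'] at h2
    have h3 := halfPoch_ne_zero (n + k)
    have h4 : Real.Gamma ((n : ℝ) + k - 1 / 2) ≠ 0 := by
      intro h
      rw [h, mul_zero] at h2
      exact mul_ne_zero (by positivity) h3 h2
    have h5 : √Real.pi ≠ 0 := by positivity
    rw [show (n : ℝ) - 3 / 2 + k + 1 = n + k - 1 / 2 by ring, besselTerm, pow_mul,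
      neg_pow ((z / 2) ^ 2)]
    generalize ((z / 2) ^ 2) ^ k = Z
    rw [eq_div_iff h5]
    have h6 : (Real.Gamma ((n : ℝ) + k - 1 / 2))⁻¹ =
        (n + k - 1 / 2) / (√Real.pi * halfPoch (n + k)) := by
      rw [h2, div_mul_cancel_left₀ h0]
    rw [div_eq_mul_inv, mul_inv, h6]
    field_simp
    ring
  have h2 := (((summable_besselTerm n ((z / 2) ^ 2)).hasSum.mul_left ((n : ℝ) - 1 / 2)).add
    (hasSum_mul_besselTerm n ((z / 2) ^ 2))).div_const (√Real.pi)
  rw [besselJ, tsum_congr h1, h2.tsum_eq, Real.rpow_sub hz2, Real.rpow_natCast,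
    show (3 / 2 : ℝ) = 1 + 1 / 2 by norm_num, Real.rpow_add hz2, Real.rpow_one,
    ← Real.sqrt_eq_rpow, riccatiBessel, riccatiBessel, pow_succ _ n]
  have h5 : √Real.pi ≠ 0 := by positivity
  have h6 : √(z / 2) ≠ 0 := by positivity
  rw [show (∑' k, besselTerm n ((z / 2) ^ 2) k) = besselSeries n ((z / 2) ^ 2) from rfl]
  generalize √(z / 2) = S at *
  generalize besselSeries n ((z / 2) ^ 2) = A at *
  generalize besselSeries (n + 1) ((z / 2) ^ 2) = B at *
  field_simp
  ring

/-! ### The Bessel kernel as an integral, its diagonal and its behaviour at zero. -/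

/-- The numerator of the Bessel kernel. -/
def besselWronskian (n : ℕ) (a b : ℝ) : ℝ :=
  b * riccatiBessel (n + 1) b * riccatiBessel n a - a * riccatiBessel (n + 1) a * riccatiBessel n b

/-- Lagrange's identity: the Wronskian expression of `u(a t)` and `u(b t)` has derivative `(b^2 -
a^2) u(a t) u(b t)`. The derivative formulas are singular at `t = 0`, so they are used only in the
interior. The boundary term at `0` vanishes, even for `n = 0`, because each product contains
`riccatiBessel (n + 1)`. -/
lemma integral_riccatiBessel_mul (n : ℕ) {a b : ℝ} (ha : a ≠ 0) (hb : b ≠ 0) :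
    (b ^ 2 - a ^ 2) * ∫ t in (0 : ℝ)..1, riccatiBessel n (a * t) * riccatiBessel n (b * t) =
      besselWronskian n a b := by
  have hc := continuous_riccatiBessel n
  have hc' := continuous_riccatiBessel (n + 1)
  have h := intervalIntegral.integral_eq_sub_of_hasDerivAt_of_le (a := 0) (b := 1)
    (f := fun t => b * riccatiBessel (n + 1) (b * t) * riccatiBessel n (a * t) -
      a * riccatiBessel (n + 1) (a * t) * riccatiBessel n (b * t))
    (f' := fun t => (b ^ 2 - a ^ 2) * (riccatiBessel n (a * t) * riccatiBessel n (b * t)))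
    zero_le_one (Continuous.continuousOn (by fun_prop)) (fun t ht => ?_)
    (Continuous.intervalIntegrable (by fun_prop) _ _)
  · rw [intervalIntegral.integral_const_mul] at h
    rw [h]
    simp [besselWronskian, riccatiBessel_succ_zero]
  · have ht0 : t ≠ 0 := ht.1.ne'
    have hl : ∀ c : ℝ, HasDerivAt (fun t => c * t) c t := fun c => by
      simpa using (hasDerivAt_id t).const_mul c
    have h0 := fun c (hc : c ≠ 0) =>
      (hasDerivAt_riccatiBessel n (mul_ne_zero hc ht0)).comp t (hl c)
    have h1 := fun c (hc : c ≠ 0) =>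
      (hasDerivAt_riccatiBessel_succ n (mul_ne_zero hc ht0)).comp t (hl c)
    have h2 := (((h1 b hb).const_mul b).mul (h0 a ha)).sub
      (((h1 a ha).const_mul a).mul (h0 b hb))
    refine h2.congr_deriv ?_
    simp only [Function.comp_apply]
    field_simp
    ring

/-- The integral representation of the Bessel kernel. -/
def besselIntegral (n : ℕ) (θ φ : ℝ) : ℝ :=
  2 * ∫ t in (0 : ℝ)..1, riccatiBessel n (Real.pi * θ * t) * riccatiBessel n (Real.pi * φ * t)

lemma besselKernel_eq_div (n : ℕ) {θ φ : ℝ} (hθ : 0 < θ) (hφ : 0 < φ) :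
    besselKernel n θ φ = 2 * besselWronskian n (Real.pi * θ) (Real.pi * φ) /
      ((Real.pi * φ) ^ 2 - (Real.pi * θ) ^ 2) := by
  have ha : 0 < Real.pi * θ := by positivity
  have hb : 0 < Real.pi * φ := by positivity
  have hp : √Real.pi ^ 2 = Real.pi := Real.sq_sqrt Real.pi_pos.le
  have h2 : √(2 : ℝ) ^ 2 = 2 := Real.sq_sqrt zero_le_two
  have e1 : (Real.pi * φ) ^ 2 - (Real.pi * θ) ^ 2 = Real.pi ^ 2 * (φ ^ 2 - θ ^ 2) := by ring
  rw [besselKernel, besselJ_sub_half n ha, besselJ_sub_half n hb, besselJ_sub_three_halves n ha,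
    besselJ_sub_three_halves n hb, besselWronskian, e1, Real.sqrt_div ha.le, Real.sqrt_div hb.le]
  have ha' : √(Real.pi * θ) ≠ 0 := by positivity
  have hb' : √(Real.pi * φ) ≠ 0 := by positivity
  have hp' : √Real.pi ≠ 0 := by positivity
  have h2' : √(2 : ℝ) ≠ 0 := by positivity
  rw [← mul_div_assoc, ← div_div (2 * _) (Real.pi ^ 2)]
  congr 1
  generalize √(Real.pi * θ) = A at *
  generalize √(Real.pi * φ) = B at *
  generalize riccatiBessel n (Real.pi * θ) = s1
  generalize riccatiBessel n (Real.pi * φ) = s2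
  generalize riccatiBessel (n + 1) (Real.pi * θ) = s3
  generalize riccatiBessel (n + 1) (Real.pi * φ) = s4
  have hpi := Real.pi_ne_zero
  field_simp
  rw [hp, h2]
  ring

lemma besselDensity_eq (n : ℕ) {θ : ℝ} (hθ : 0 < θ) :
    besselDensity n θ = riccatiBessel n (Real.pi * θ) ^ 2 +
      riccatiBessel (n + 1) (Real.pi * θ) ^ 2 - (2 * n - 1) / (Real.pi * θ) *
        (riccatiBessel n (Real.pi * θ) * riccatiBessel (n + 1) (Real.pi * θ)) := by
  have ha : 0 < Real.pi * θ := by positivity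
  have h : (√(Real.pi * θ / 2) * √Real.pi) ^ 2 = Real.pi ^ 2 * θ / 2 := by
    rw [mul_pow, Real.sq_sqrt (by positivity), Real.sq_sqrt Real.pi_pos.le]
    ring
  have h0 : √(Real.pi * θ / 2) * √Real.pi ≠ 0 := by positivity
  rw [besselDensity, besselJ_sub_half n ha, besselJ_sub_three_halves n ha]
  generalize √(Real.pi * θ / 2) * √Real.pi = S at *
  generalize riccatiBessel n (Real.pi * θ) = s
  generalize riccatiBessel (n + 1) (Real.pi * θ) = s'
  rw [show Real.pi ^ 2 / 2 * θ = S ^ 2 by rw [h]; ring]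
  field_simp
  ring

lemma besselKernel_eq_integral (n : ℕ) {θ φ : ℝ} (hθ : 0 < θ) (hφ : 0 < φ) (h : θ ≠ φ) :
    besselKernel n θ φ = besselIntegral n θ φ := by
  have ha : 0 < Real.pi * θ := by positivity
  have hb : 0 < Real.pi * φ := by positivity
  have h0 : (Real.pi * φ) ^ 2 - (Real.pi * θ) ^ 2 ≠ 0 := by
    rw [sub_ne_zero, Ne, sq_eq_sq₀ hb.le ha.le]
    exact fun h' => h (mul_left_cancel₀ Real.pi_ne_zero h').symm
  rw [besselKernel_eq_div n hθ hφ, ← integral_riccatiBessel_mul n ha.ne' hb.ne', besselIntegral,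
    mul_left_comm, mul_div_cancel_left₀ _ h0]

/-- The numerator vanishes at `φ = θ`, so the limit is its derivative there divided by that of the
denominator. -/
lemma tendsto_besselKernel (n : ℕ) {θ : ℝ} (hθ : 0 < θ) :
    Tendsto (fun φ => besselKernel n θ φ) (𝓝[≠] θ) (𝓝 (besselDensity n θ)) := by
  have ha : 0 < Real.pi * θ := by positivity
  have hpi := Real.pi_ne_zero
  have hd : HasDerivAt (fun φ => besselWronskian n (Real.pi * θ) (Real.pi * φ))
      (Real.pi * (Real.pi * θ) * besselDensity n θ) θ := by
    have hl : HasDerivAt (fun φ => Real.pi * φ) Real.pi θ := by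
      simpa using (hasDerivAt_id θ).const_mul Real.pi
    have h0 := (hasDerivAt_riccatiBessel n ha.ne').comp θ hl
    have h1 := (hasDerivAt_riccatiBessel_succ n ha.ne').comp θ hl
    have h2 := ((hl.mul h1).mul_const (riccatiBessel n (Real.pi * θ))).sub
      (h0.const_mul (Real.pi * θ * riccatiBessel (n + 1) (Real.pi * θ)))
    refine h2.congr_deriv ?_
    simp only [Function.comp_apply]
    rw [besselDensity_eq n hθ]
    field_simp
    ring
  have h1 := (hasDerivAt_iff_tendsto_slope.1 hd)
  have h2 : Tendsto (fun φ : ℝ => 2 / (Real.pi ^ 2 * (φ + θ))) (𝓝[≠] θ)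
      (𝓝 (2 / (Real.pi ^ 2 * (θ + θ)))) := by
    refine Tendsto.mono_left ?_ nhdsWithin_le_nhds
    have : ContinuousAt (fun φ : ℝ => 2 / (Real.pi ^ 2 * (φ + θ))) θ :=
      ContinuousAt.div continuousAt_const (by fun_prop) (by positivity)
    exact this.tendsto
  have h3 := h1.mul h2
  have e : Real.pi * (Real.pi * θ) * besselDensity n θ * (2 / (Real.pi ^ 2 * (θ + θ))) =
      besselDensity n θ := by
    field_simp
    ring
  rw [e] at h3
  refine h3.congr' ?_
  filter_upwards [self_mem_nhdsWithin, nhdsWithin_le_nhds (lt_mem_nhds hθ)] with φ hφ hφ0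
  have h4 : φ - θ ≠ 0 := sub_ne_zero.2 hφ
  have h5 : φ + θ ≠ 0 := by positivity
  have h6 : besselWronskian n (Real.pi * θ) (Real.pi * θ) = 0 := by
    rw [besselWronskian, sub_self]
  rw [besselKernel_eq_div n hθ hφ0, slope_def_field, h6, sub_zero,
    show (Real.pi * φ) ^ 2 - (Real.pi * θ) ^ 2 = Real.pi ^ 2 * ((φ + θ) * (φ - θ)) by ring]
  field_simp

lemma continuous_besselIntegral (n : ℕ) (θ : ℝ) : Continuous (besselIntegral n θ) := by
  have := continuous_riccatiBessel n
  refine continuous_const.mul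
    (intervalIntegral.continuous_parametric_intervalIntegral_of_continuous' ?_ _ _)
  simp only [Function.uncurry_def]
  fun_prop

lemma besselDensity_eq_integral (n : ℕ) {θ : ℝ} (hθ : 0 < θ) :
    besselDensity n θ = besselIntegral n θ θ := by
  refine tendsto_nhds_unique (tendsto_besselKernel n hθ) ?_
  have h := ((continuous_besselIntegral n θ).tendsto θ).mono_left
    (nhdsWithin_le_nhds (s := {θ}ᶜ))
  refine h.congr' ?_
  filter_upwards [self_mem_nhdsWithin, nhdsWithin_le_nhds (lt_mem_nhds hθ)] with φ hφ hφ0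
  exact (besselKernel_eq_integral n hθ hφ0 (Ne.symm hφ)).symm

lemma exists_tendsto_besselDensity_div (n : ℕ) : ∃ c : ℝ, 0 < c ∧
    Tendsto (fun θ : ℝ => besselDensity n θ / θ ^ (2 * n)) (𝓝[>] 0) (𝓝 c) := by
  have hpos := halfPoch_pos n
  have hpi := Real.pi_pos
  -- The integral representation with `θ ^ (2 * n)` taken out: a continuous function that is
  -- positive at `0`.
  let F : ℝ → ℝ := fun θ => 2 * ∫ t in (0 : ℝ)..1,
    (Real.pi / 2 * t) ^ (2 * n) * besselSeries n ((Real.pi * θ * t / 2) ^ 2) ^ 2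
  have hF : Continuous F := by
    have := continuous_besselSeries n
    refine continuous_const.mul
      (intervalIntegral.continuous_parametric_intervalIntegral_of_continuous' ?_ _ _)
    simp only [Function.uncurry_def]
    fun_prop
  have hF0 : F 0 = 2 * ((Real.pi / 2) ^ (2 * n) * (1 / (2 * n + 1)) * (halfPoch n)⁻¹ ^ 2) := by
    simp only [F, mul_zero, zero_mul, zero_div, ne_eq, OfNat.ofNat_ne_zero, not_false_eq_true,
      zero_pow, besselSeries_zero_right, mul_pow]
    rw [intervalIntegral.integral_mul_const, intervalIntegral.integral_const_mul, integral_pow]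
    simp
  refine ⟨F 0, by rw [hF0]; positivity, ?_⟩
  refine ((hF.tendsto 0).mono_left (nhdsWithin_le_nhds (s := Set.Ioi 0))).congr' ?_
  filter_upwards [self_mem_nhdsWithin] with θ hθ
  have hθ : 0 < θ := hθ
  rw [besselDensity_eq_integral n hθ, besselIntegral, eq_div_iff (by positivity)]
  simp only [F]
  rw [mul_assoc, ← intervalIntegral.integral_mul_const]
  congr 1
  refine intervalIntegral.integral_congr fun t _ => ?_
  simp only [riccatiBessel]
  rw [show Real.pi * θ * t / 2 = Real.pi / 2 * t * θ by ring]
  ring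

/-! ### Riemann sums and the scaling limit of the kernel. -/

lemma integral_comp_floor_mul (h : ℕ → ℝ) {M : ℕ} (hM : M ≠ 0) :
    ∫ t in (0 : ℝ)..1, h ⌊t * M⌋₊ = (M : ℝ)⁻¹ * ∑ j ∈ range M, h j := by
  have hM0 : (M : ℝ) ≠ 0 := by exact_mod_cast hM
  have heq : ∀ k : ℕ, Set.EqOn (fun _ : ℝ => h k) (fun u : ℝ => h ⌊u⌋₊)
      (Set.Ioo (k : ℝ) ((k + 1 : ℕ) : ℝ)) := by
    intro k u hu
    have : ⌊u⌋₊ = k := (Nat.floor_eq_iff ((Nat.cast_nonneg k).trans hu.1.le)).2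
      ⟨hu.1.le, by exact_mod_cast hu.2⟩
    simp only [this]
  have hle : ∀ k : ℕ, (k : ℝ) ≤ ((k + 1 : ℕ) : ℝ) := fun k => by exact_mod_cast Nat.le_succ k
  have hint : ∀ k < M, IntervalIntegrable (fun u : ℝ => h ⌊u⌋₊) volume (k : ℝ)
      ((k + 1 : ℕ) : ℝ) := fun k _ =>
    (intervalIntegrable_const (c := h k)).congr_uIoo (by rw [Set.uIoo_of_le (hle k)]; exact heq k)
  rw [intervalIntegral.integral_comp_mul_right (fun u : ℝ => h ⌊u⌋₊) hM0, zero_mul, one_mul,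
    smul_eq_mul]
  have := intervalIntegral.sum_integral_adjacent_intervals (a := fun k : ℕ => (k : ℝ)) hint
  simp only [Nat.cast_zero] at this
  rw [← this]
  congr 1
  refine sum_congr rfl fun k _ => ?_
  rw [← intervalIntegral.integral_congr_Ioo_of_le (hle k) (heq k)]
  simp

/-- Convergence of Riemann sums whose summands converge boundedly. -/
lemma tendsto_inv_mul_sum_range {g : ℕ → ℕ → ℝ} {G : ℝ → ℝ} {C : ℝ}
    (hb : ∀ M ≠ 0, ∀ j ≤ M, |g M j| ≤ C)
    (hl : ∀ t ∈ Set.Ioc (0 : ℝ) 1, Tendsto (fun M : ℕ => g M ⌊t * M⌋₊) atTop (𝓝 (G t))) :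
    Tendsto (fun M : ℕ => (M : ℝ)⁻¹ * ∑ j ∈ range M, g M j) atTop
        (𝓝 (∫ t in (0 : ℝ)..1, G t)) ∧
      Tendsto (fun M : ℕ => (M : ℝ)⁻¹ * ∑ j ∈ range (M + 1), g M j) atTop
        (𝓝 (∫ t in (0 : ℝ)..1, G t)) := by
  have h1 : Tendsto (fun M : ℕ => (M : ℝ)⁻¹ * ∑ j ∈ range M, g M j) atTop
      (𝓝 (∫ t in (0 : ℝ)..1, G t)) := by
    have h := intervalIntegral.tendsto_integral_filter_of_dominated_convergence
      (a := 0) (b := 1) (μ := volume) (l := atTop) (f := G)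
      (F := fun M : ℕ => fun t : ℝ => g M ⌊t * M⌋₊) (fun _ => C) ?_ ?_
      intervalIntegrable_const ?_
    · refine h.congr' ?_
      filter_upwards [eventually_ne_atTop 0] with M hM
      exact integral_comp_floor_mul (g M) hM
    · refine Eventually.of_forall fun M => Measurable.aestronglyMeasurable ?_
      exact (measurable_from_top (f := g M)).comp
        (Nat.measurable_floor.comp (measurable_id.mul_const _))
    · filter_upwards [eventually_ne_atTop 0] with M hM
      refine Eventually.of_forall fun t ht => ?_
      rw [Set.uIoc_of_le zero_le_one] at ht
      refine hb M hM _ (Nat.floor_le_of_le ?_)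
      exact mul_le_of_le_one_left (Nat.cast_nonneg M) ht.2
    · refine Eventually.of_forall fun t ht => ?_
      rw [Set.uIoc_of_le zero_le_one] at ht
      exact hl t ht
  refine ⟨h1, ?_⟩
  -- The additional summand `j = M` converges by the hypothesis at `t = 1`, so division by `M` makes
  -- it negligible.
  have h2 : Tendsto (fun M : ℕ => (M : ℝ)⁻¹ * g M M) atTop (𝓝 0) := by
    have := (tendsto_inv_atTop_nhds_zero_nat (𝕜 := ℝ)).mul (hl 1 ⟨zero_lt_one, le_rfl⟩)
    simpa using this
  have h3 := h1.add h2
  rw [add_zero] at h3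
  refine h3.congr fun M => ?_
  rw [sum_range_succ, mul_add]

lemma tendsto_mul_sin_div (a : ℝ) :
    Tendsto (fun M : ℕ => (M : ℝ) * Real.sin (a / M / 2)) atTop (𝓝 (a / 2)) := by
  have h0 : Tendsto (fun M : ℕ => a / M / 2) atTop (𝓝 0) := by
    simpa using (tendsto_const_div_atTop_nhds_zero_nat a).div_const 2
  have h1 := ((Real.continuous_sinc.tendsto 0).comp h0).const_mul (a / 2)
  rw [Real.sinc_zero, mul_one] at h1
  refine h1.congr' ?_
  filter_upwards [eventually_ne_atTop 0] with M hM
  have hM0 : (M : ℝ) ≠ 0 := by exact_mod_cast hM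
  rcases eq_or_ne a 0 with rfl | ha
  · simp
  · simp only [Function.comp_apply]
    rw [Real.sinc_of_ne_zero (by positivity)]
    field_simp

lemma abs_mul_sin_div_le (a : ℝ) (M : ℕ) : |(M : ℝ) * Real.sin (a / M / 2)| ≤ |a| / 2 := by
  rcases eq_or_ne M 0 with rfl | hM
  · simpa using div_nonneg (abs_nonneg a) zero_le_two
  · have hM0 : (0 : ℝ) < M := by exact_mod_cast Nat.pos_of_ne_zero hM
    rw [abs_mul, abs_of_pos hM0]
    calc (M : ℝ) * |Real.sin (a / M / 2)| ≤ M * |a / M / 2| := by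
          exact mul_le_mul_of_nonneg_left Real.abs_sin_le_abs hM0.le
      _ = |a| / 2 := by
          rw [abs_div, abs_div, abs_of_pos hM0, abs_two]
          field_simp

/-- For `i < j` each factor satisfies `|e_i - e_j| ≤ e_j`, so only the product `e_j |s|` matters. In
the scaling regime it stays bounded, which gives an exponential majorant independent of `M` and `j`.
-/
lemma abs_jacobiCoeff_mul_pow_le (n j v : ℕ) {s x : ℝ} (h : jacobiEigen n j * |s| ≤ x) :
    |jacobiCoeff n j v * s ^ v| ≤ (2 * x) ^ v / v.factorial := by
  have hj : 0 ≤ jacobiEigen n j := by unfold jacobiEigen; positivity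
  have hx : 0 ≤ x := le_trans (by positivity) h
  rcases lt_or_ge j v with hv | hv
  · rw [jacobiCoeff_eq_zero hv, zero_mul, abs_zero]
    positivity
  · have h0 := halfPoch_pos n
    have h1 : |∏ i ∈ range v, (jacobiEigen n i - jacobiEigen n j)| ≤ jacobiEigen n j ^ v := by
      rw [abs_prod]
      refine (prod_le_prod (fun _ _ => abs_nonneg _) (g := fun _ => jacobiEigen n j)
        fun i hi => ?_).trans (by simp)
      have hij : i < j := (mem_range.1 hi).trans_le hv
      have hi0 : 0 ≤ jacobiEigen n i := by unfold jacobiEigen; positivity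
      rw [abs_sub_comm, abs_of_pos (sub_pos.2 (jacobiEigen_lt hij))]
      linarith
    have hp : 0 < (v.factorial : ℝ) * halfPoch (n + v) :=
      mul_pos (by positivity) (halfPoch_pos _)
    calc |jacobiCoeff n j v * s ^ v|
        = |∏ i ∈ range v, (jacobiEigen n i - jacobiEigen n j)| * |s| ^ v * halfPoch n /
            (v.factorial * halfPoch (n + v)) := by
          rw [jacobiCoeff, abs_mul, abs_div, abs_mul, abs_pow, abs_of_pos h0, abs_of_pos hp]
          ring
      _ ≤ jacobiEigen n j ^ v * |s| ^ v * halfPoch n / (v.factorial * halfPoch (n + v)) := by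
          gcongr
      _ ≤ x ^ v * halfPoch n / (v.factorial * halfPoch (n + v)) := by
          rw [← mul_pow]
          gcongr
      _ = halfPoch n * (x ^ v / (v.factorial * halfPoch (n + v))) := by ring
      _ ≤ halfPoch n * ((halfPoch n)⁻¹ * ((2 * x) ^ v / v.factorial)) := by
          gcongr
          exact pow_div_factorial_mul_halfPoch_le hx n v
      _ = _ := by rw [mul_inv_cancel_left₀ h0.ne']

lemma eval_jacobiPoly_eq_tsum (n j : ℕ) (s : ℝ) :
    (jacobiPoly n j).eval s = ∑' v, jacobiCoeff n j v * s ^ v := by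
  rw [eval_jacobiPoly, tsum_eq_sum]
  intro v hv
  rw [jacobiCoeff_eq_zero (by simpa [Nat.lt_succ_iff] using hv), zero_mul]

lemma jacobiEigen_mul_sin_sq_le (n : ℕ) (a : ℝ) {M j : ℕ} (hM : M ≠ 0) (hj : j ≤ M) :
    jacobiEigen n j * |Real.sin (a / M / 2) ^ 2| ≤ (n + 1) * (a / 2) ^ 2 := by
  have hM1 : (1 : ℝ) ≤ M := by exact_mod_cast Nat.one_le_iff_ne_zero.2 hM
  have hj' : (j : ℝ) ≤ M := by exact_mod_cast hj
  have hn : (0 : ℝ) ≤ n := Nat.cast_nonneg n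
  have h1 : jacobiEigen n j ≤ (n + 1) * M ^ 2 := by
    unfold jacobiEigen
    calc (j : ℝ) * (j + n) ≤ M * (M + n * M) := by
          gcongr
          exact le_mul_of_one_le_right hn hM1
      _ = _ := by ring
  have h2 := sq_le_sq' (neg_le_of_abs_le (abs_mul_sin_div_le a M))
    (le_of_abs_le (abs_mul_sin_div_le a M))
  rw [abs_of_nonneg (sq_nonneg _)]
  calc jacobiEigen n j * Real.sin (a / M / 2) ^ 2
      ≤ (n + 1) * M ^ 2 * Real.sin (a / M / 2) ^ 2 := by gcongr
    _ = (n + 1) * (M * Real.sin (a / M / 2)) ^ 2 := by ring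
    _ ≤ (n + 1) * (|a| / 2) ^ 2 := by gcongr
    _ = _ := by rw [div_pow, sq_abs, div_pow]

lemma abs_eval_jacobiPoly_le (n : ℕ) (a : ℝ) {M j : ℕ} (hM : M ≠ 0) (hj : j ≤ M) :
    |(jacobiPoly n j).eval (Real.sin (a / M / 2) ^ 2)| ≤
      ∑' v : ℕ, (2 * ((n + 1) * (a / 2) ^ 2)) ^ v / v.factorial := by
  rw [eval_jacobiPoly_eq_tsum, ← Real.norm_eq_abs]
  exact tsum_of_norm_bounded (Real.summable_pow_div_factorial _).hasSum fun v =>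
    abs_jacobiCoeff_mul_pow_le n j v (jacobiEigen_mul_sin_sq_le n a hM hj)

/-- Mehler-Heine limit: for `j ∼ t M` the eigenvalue `e_j` grows like `(t M)^2` and the sine squared
like `(a / (2 M))^2`, so each factor tends to `-(a t / 2)^2`; dominated convergence sums the terms.
-/
lemma tendsto_eval_jacobiPoly (n : ℕ) (a : ℝ) {t : ℝ} {j : ℕ → ℕ} (hj : ∀ M, j M ≤ M)
    (ht : Tendsto (fun M => (j M : ℝ) / M) atTop (𝓝 t)) :
    Tendsto (fun M : ℕ => (jacobiPoly n (j M)).eval (Real.sin (a / M / 2) ^ 2)) atTop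
      (𝓝 (halfPoch n * besselSeries n ((a * t / 2) ^ 2))) := by
  simp only [eval_jacobiPoly_eq_tsum]
  rw [besselSeries, ← tsum_mul_left]
  refine tendsto_tsum_of_dominated_convergence
    (Real.summable_pow_div_factorial (2 * ((n + 1) * (a / 2) ^ 2))) (fun v => ?_) ?_
  · have hs := tendsto_mul_sin_div a
    have hinv := tendsto_inv_atTop_nhds_zero_nat (𝕜 := ℝ)
    have h1 : ∀ i : ℕ, Tendsto (fun M : ℕ => (jacobiEigen n i - jacobiEigen n (j M)) *
        Real.sin (a / M / 2) ^ 2) atTop (𝓝 (-(a * t / 2) ^ 2)) := by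
      intro i
      have h2 := ((hinv.pow 2).const_mul (jacobiEigen n i)).sub
        (ht.mul (ht.add (hinv.const_mul (n : ℝ))))
      have h3 := h2.mul (hs.pow 2)
      have e : (jacobiEigen n i * 0 ^ 2 - t * (t + n * 0)) * (a / 2) ^ 2 = -(a * t / 2) ^ 2 := by
        ring
      rw [e] at h3
      refine h3.congr' ?_
      filter_upwards [eventually_ne_atTop 0] with M hM
      have hM0 : (M : ℝ) ≠ 0 := by exact_mod_cast hM
      rw [jacobiEigen, jacobiEigen]
      field_simp
    have h4 := (tendsto_finsetProd (range v) fun i _ => h1 i).mul_const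
      (halfPoch n / (v.factorial * halfPoch (n + v)))
    rw [prod_const, card_range] at h4
    convert h4 using 2
    · rw [prod_mul_distrib, prod_const, card_range, jacobiCoeff]
      ring
    · rw [besselTerm]
      ring
  · filter_upwards [eventually_ne_atTop 0] with M hM v
    exact abs_jacobiCoeff_mul_pow_le n (j M) v (jacobiEigen_mul_sin_sq_le n a hM (hj M))

/-- As a polynomial in `j` of degree `2 n`, the growth is visible: it matches the `M ^ (2 * n)`
supplied by the two factors `sin ^ n`. -/
lemma jacobiRho_eq_prod (n j : ℕ) : jacobiRho n j =
    (∏ i ∈ range n, (((j : ℝ) + i + 1) * (j + i + 1 / 2))) /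
      (2 ^ n * Real.pi * halfPoch n ^ 2) := by
  have h : ((j + n).factorial : ℝ) * halfPoch (j + n) = j.factorial * halfPoch j *
      ∏ i ∈ range n, (((j : ℝ) + i + 1) * (j + i + 1 / 2)) := by
    induction n with
    | zero => simp
    | succ n ih =>
      rw [prod_range_succ, ← add_assoc, Nat.factorial_succ, halfPoch_succ]
      push_cast
      linear_combination ((j : ℝ) + n + 1) * (j + n + 1 / 2) * ih
  have := halfPoch_ne_zero j
  have := halfPoch_ne_zero n
  have := Real.pi_ne_zero
  rw [jacobiRho, h]
  generalize ∏ i ∈ range n, (((j : ℝ) + i + 1) * (j + i + 1 / 2)) = A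
  field_simp

lemma jacobiInvNorm_le (n : ℕ) {M j : ℕ} (hM : M ≠ 0) (hj : j ≤ M) :
    jacobiInvNorm n j / M ^ (2 * n) ≤
      2 * ((n + 1) ^ (2 * n) / (2 ^ n * Real.pi * halfPoch n ^ 2)) := by
  have hM1 : (1 : ℝ) ≤ M := by exact_mod_cast Nat.one_le_iff_ne_zero.2 hM
  have hj' : (j : ℝ) ≤ M := by exact_mod_cast hj
  have hn : (0 : ℝ) ≤ n := Nat.cast_nonneg n
  have hp := halfPoch_pos n
  have hpi := Real.pi_pos
  have h1 : jacobiInvNorm n j ≤ 2 * jacobiRho n j := by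
    have := jacobiRho_pos n j
    unfold jacobiInvNorm
    split_ifs with h
    · linarith
    · have hj0 : (0 : ℝ) < j := by exact_mod_cast Nat.pos_of_ne_zero h
      gcongr
      rw [div_le_iff₀ (by positivity)]
      linarith
  have h2 : ∏ i ∈ range n, (((j : ℝ) + i + 1) * (j + i + 1 / 2)) ≤
      ((n + 1) ^ (2 * n)) * M ^ (2 * n) := by
    rw [← mul_pow, pow_mul]
    refine (prod_le_prod (g := fun _ => (((n : ℝ) + 1) * M) ^ 2) (fun i _ => by positivity)
      fun i hi => ?_).trans (by simp)
    have hi' : (i : ℝ) + 1 ≤ n := by exact_mod_cast mem_range.1 hi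
    have h3 : (j : ℝ) + i + 1 ≤ (n + 1) * M := by nlinarith
    rw [sq]
    exact mul_le_mul h3 (by linarith) (by positivity) (by positivity)
  rw [div_le_iff₀ (by positivity)]
  refine h1.trans ?_
  rw [jacobiRho_eq_prod, mul_assoc 2 (_ / _), div_mul_eq_mul_div]
  gcongr

lemma tendsto_jacobiInvNorm (n : ℕ) {t : ℝ} (ht0 : 0 < t) {j : ℕ → ℕ}
    (ht : Tendsto (fun M => (j M : ℝ) / M) atTop (𝓝 t)) :
    Tendsto (fun M : ℕ => jacobiInvNorm n (j M) / M ^ (2 * n)) atTop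
      (𝓝 (2 * (t ^ (2 * n) / (2 ^ n * Real.pi * halfPoch n ^ 2)))) := by
  have hinv := tendsto_inv_atTop_nhds_zero_nat (𝕜 := ℝ)
  have h1 : ∀ c : ℝ, Tendsto (fun M : ℕ => (j M : ℝ) / M + c * (M : ℝ)⁻¹) atTop (𝓝 t) := by
    intro c
    simpa using ht.add (hinv.const_mul c)
  have h2 : Tendsto (fun M : ℕ => (2 * ((j M : ℝ) / M) + n * (M : ℝ)⁻¹) /
      ((j M : ℝ) / M + n * (M : ℝ)⁻¹)) atTop (𝓝 2) := by
    have := ((ht.const_mul 2).add (hinv.const_mul (n : ℝ))).div (h1 n) ht0.ne'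
    simpa [ht0.ne'] using! this
  have h3 := (tendsto_finsetProd (range n) fun i _ =>
    (h1 ((i : ℝ) + 1)).mul (h1 ((i : ℝ) + 1 / 2))).div_const (2 ^ n * Real.pi * halfPoch n ^ 2)
  rw [prod_const, card_range, ← sq, ← pow_mul] at h3
  refine (h2.mul h3).congr' ?_
  filter_upwards [eventually_ne_atTop 0, ht.eventually_ne ht0.ne'] with M hM hjM
  have hM0 : (M : ℝ) ≠ 0 := by exact_mod_cast hM
  have hj0 : j M ≠ 0 := by
    rintro h
    simp [h] at hjM
  have hj1 : (0 : ℝ) < j M := by exact_mod_cast Nat.pos_of_ne_zero hj0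
  have e1 : ∀ c : ℝ, (j M : ℝ) / M + c * (M : ℝ)⁻¹ = (j M + c) * (M : ℝ)⁻¹ := fun c => by ring
  have e2 : 2 * ((j M : ℝ) / M) + n * (M : ℝ)⁻¹ = (2 * j M + n) * (M : ℝ)⁻¹ := by ring
  have e3 : ∀ i : ℕ, ((j M : ℝ) + (i + 1)) * (M : ℝ)⁻¹ * ((j M + (i + 1 / 2)) * (M : ℝ)⁻¹) =
      ((j M : ℝ) + i + 1) * (j M + i + 1 / 2) * ((M : ℝ)⁻¹ ^ 2) := fun i => by ring
  simp only [e1, e2, e3]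
  rw [prod_mul_distrib, prod_const, card_range, jacobiInvNorm, if_neg hj0, jacobiRho_eq_prod,
    mul_div_mul_right _ _ (inv_ne_zero hM0), ← pow_mul, inv_pow]
  ring

/-- The scaled summand of the weighted kernel. -/
def scaledTerm (n : ℕ) (a b : ℝ) (M j : ℕ) : ℝ :=
  Real.pi * 2 ^ n * (M * Real.sin (a / M / 2)) ^ n * (M * Real.sin (b / M / 2)) ^ n *
    (jacobiInvNorm n j / M ^ (2 * n)) *
      (jacobiPoly n j).eval (Real.sin (a / M / 2) ^ 2) *
        (jacobiPoly n j).eval (Real.sin (b / M / 2) ^ 2)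

/-- The number of terms `N` is kept apart from the scale `M`, so that `N = M` and `N = M + 1` are
both covered. -/
lemma weightedKernel_eq_sum_scaledTerm (n N : ℕ) (a b : ℝ) {M : ℕ} (hM : M ≠ 0) :
    Real.pi / M * weightedKernel n N (a / M) (b / M) =
      (M : ℝ)⁻¹ * ∑ j ∈ range N, scaledTerm n a b M j := by
  have hM0 : (M : ℝ) ≠ 0 := by exact_mod_cast hM
  have hs : ∀ θ : ℝ, (1 - Real.cos θ) / 2 = Real.sin (θ / 2) ^ 2 := fun θ => by
    rw [← two_mul_sin_half_sq]; ring
  rw [weightedKernel, jacobiKernel_eq, div_eq_inv_mul, mul_assoc, mul_sum, mul_sum]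
  congr 1
  refine sum_congr rfl fun j _ => ?_
  rw [hs, hs, scaledTerm, mul_pow, mul_pow, two_mul n, pow_add]
  field_simp

lemma exists_abs_scaledTerm_le (n : ℕ) (a b : ℝ) :
    ∃ C : ℝ, ∀ M ≠ 0, ∀ j ≤ M, |scaledTerm n a b M j| ≤ C := by
  refine ⟨Real.pi * 2 ^ n * (|a| / 2) ^ n * (|b| / 2) ^ n *
    (2 * ((n + 1) ^ (2 * n) / (2 ^ n * Real.pi * halfPoch n ^ 2))) *
    (∑' v : ℕ, (2 * ((n + 1) * (a / 2) ^ 2)) ^ v / v.factorial) *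
    (∑' v : ℕ, (2 * ((n + 1) * (b / 2) ^ 2)) ^ v / v.factorial), fun M hM j hj => ?_⟩
  have h0 : 0 ≤ jacobiInvNorm n j / (M : ℝ) ^ (2 * n) :=
    div_nonneg (jacobiInvNorm_pos n j).le (by positivity)
  have hpi := Real.pi_pos
  have hp := halfPoch_pos n
  have hE : ∀ a : ℝ, 0 ≤ ∑' v : ℕ, (2 * (((n : ℝ) + 1) * (a / 2) ^ 2)) ^ v / v.factorial :=
    fun a => tsum_nonneg fun v => by positivity
  have := hE a
  rw [scaledTerm, abs_mul, abs_mul, abs_mul, abs_mul, abs_mul, abs_mul, abs_of_pos hpi,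
    abs_of_nonneg h0, abs_pow, abs_pow, abs_pow, abs_two]
  gcongr
  · exact abs_mul_sin_div_le a M
  · exact abs_mul_sin_div_le b M
  · exact jacobiInvNorm_le n hM hj
  · exact abs_eval_jacobiPoly_le n a hM hj
  · exact abs_eval_jacobiPoly_le n b hM hj

lemma tendsto_scaledTerm (n : ℕ) (a b : ℝ) {t : ℝ} (ht : t ∈ Set.Ioc (0 : ℝ) 1) :
    Tendsto (fun M : ℕ => scaledTerm n a b M ⌊t * M⌋₊) atTop
      (𝓝 (2 * (riccatiBessel n (a * t) * riccatiBessel n (b * t)))) := by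
  have hj : ∀ M : ℕ, ⌊t * M⌋₊ ≤ M := fun M =>
    Nat.floor_le_of_le (mul_le_of_le_one_left (Nat.cast_nonneg M) ht.2)
  have hl : Tendsto (fun M : ℕ => (⌊t * M⌋₊ : ℝ) / M) atTop (𝓝 t) :=
    (tendsto_nat_floor_mul_div_atTop ht.1.le).comp tendsto_natCast_atTop_atTop
  have h := (((((((tendsto_mul_sin_div a).pow n).const_mul (Real.pi * 2 ^ n)).mul
    ((tendsto_mul_sin_div b).pow n)).mul (tendsto_jacobiInvNorm n ht.1 hl)).mul
    (tendsto_eval_jacobiPoly n a hj hl)).mul (tendsto_eval_jacobiPoly n b hj hl))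
  refine (h.congr fun M => rfl).trans_eq ?_
  have := halfPoch_ne_zero n
  have := Real.pi_ne_zero
  rw [riccatiBessel, riccatiBessel, show a * t / 2 = a / 2 * t by ring,
    show b * t / 2 = b / 2 * t by ring, mul_pow (a / 2) t n, mul_pow (b / 2) t n, two_mul n,
    pow_add]
  generalize (a / 2) ^ n = A
  generalize (b / 2) ^ n = B
  congr 1
  field_simp

theorem tendsto_weightedKernel (n : ℕ) (θ φ : ℝ) :
    Tendsto (fun M : ℕ => Real.pi / M *
        weightedKernel n M (Real.pi * θ / M) (Real.pi * φ / M)) atTop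
        (𝓝 (besselIntegral n θ φ)) ∧
      Tendsto (fun M : ℕ => Real.pi / M *
        weightedKernel n (M + 1) (Real.pi * θ / M) (Real.pi * φ / M)) atTop
        (𝓝 (besselIntegral n θ φ)) := by
  obtain ⟨C, hC⟩ := exists_abs_scaledTerm_le n (Real.pi * θ) (Real.pi * φ)
  have h := tendsto_inv_mul_sum_range hC fun t ht =>
    tendsto_scaledTerm n (Real.pi * θ) (Real.pi * φ) ht
  rw [intervalIntegral.integral_const_mul] at h
  refine ⟨h.1.congr' ?_, h.2.congr' ?_⟩ <;>
  filter_upwards [eventually_ne_atTop 0] with M hM <;>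
  rw [weightedKernel_eq_sum_scaledTerm n _ _ _ hM]

lemma kernelDet_one (n M : ℕ) (θ : Fin 1 → ℝ) :
    kernelDet n M 1 θ = weightedKernel n M (θ 0) (θ 0) := by
  simp [kernelDet]

end ConditionedSO

end

theorem mainTheorem4 (n : ℕ) :
    -- orthogonality of the Jacobi polynomials, with squared norms `h_j`
    (∀ i j : ℕ,
      ∫ θ in (0 : ℝ)..Real.pi,
          ConditionedSO.jacobiP (n - 1 / 2) (-1 / 2) i (Real.cos θ) *
            ConditionedSO.jacobiP (n - 1 / 2) (-1 / 2) j (Real.cos θ) *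
              (1 - Real.cos θ) ^ n =
        if i = j then ConditionedSO.jacobiH (n - 1 / 2) (-1 / 2) i else 0) ∧
    -- the `m`-level densities are determinants
    (∀ M m : ℕ, ConditionedSO.IsLevelDensity n M m (ConditionedSO.kernelDet n M m)) ∧
    (∀ M m : ℕ, ∀ θ : Fin m → ℝ,
      ConditionedSO.kernelDet n M m θ =
        (Matrix.of fun j k : Fin m => ConditionedSO.jacobiKernel n M (θ j) (θ k)).det *
          ∏ j, (1 - Real.cos (θ j)) ^ n) ∧
    -- the Christoffel-Darboux form of the kernel
    (∀ M : ℕ, ∀ θ φ : ℝ, Real.cos θ ≠ Real.cos φ →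
      ConditionedSO.jacobiKernel n (M + 1) θ φ =
        2 ^ (1 - n : ℝ) / (2 * M + n + 1) *
          (Real.Gamma (M + 2) * Real.Gamma (M + n + 1) /
            (Real.Gamma (M + n + 1 / 2) * Real.Gamma (M + 1 / 2))) *
          ((ConditionedSO.jacobiP (n - 1 / 2) (-1 / 2) (M + 1) (Real.cos θ) *
                ConditionedSO.jacobiP (n - 1 / 2) (-1 / 2) M (Real.cos φ) -
              ConditionedSO.jacobiP (n - 1 / 2) (-1 / 2) M (Real.cos θ) *
                ConditionedSO.jacobiP (n - 1 / 2) (-1 / 2) (M + 1) (Real.cos φ)) /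
            (Real.cos θ - Real.cos φ))) ∧
    -- the scaling limit of the weighted kernel off the diagonal, with `M` and with `M + 1` terms
    (∀ θ φ : ℝ, 0 < θ → 0 < φ → θ ≠ φ →
      Tendsto (fun M : ℕ => Real.pi / M *
          ConditionedSO.weightedKernel n M (Real.pi * θ / M) (Real.pi * φ / M))
        atTop (𝓝 (ConditionedSO.besselKernel n θ φ)) ∧
      Tendsto (fun M : ℕ => Real.pi / M *
          ConditionedSO.weightedKernel n (M + 1) (Real.pi * θ / M) (Real.pi * φ / M))
        atTop (𝓝 (ConditionedSO.besselKernel n θ φ))) ∧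
    -- the scaling limit on the diagonal, and its agreement with the Bessel kernel
    (∀ θ : ℝ, 0 < θ →
      Tendsto (fun M : ℕ => Real.pi / M *
          ConditionedSO.weightedKernel n M (Real.pi * θ / M) (Real.pi * θ / M))
        atTop (𝓝 (ConditionedSO.besselDensity n θ)) ∧
      Tendsto (fun M : ℕ => Real.pi / M *
          ConditionedSO.weightedKernel n (M + 1) (Real.pi * θ / M) (Real.pi * θ / M))
        atTop (𝓝 (ConditionedSO.besselDensity n θ)) ∧
      Tendsto (fun φ : ℝ => ConditionedSO.besselKernel n θ φ) (𝓝[≠] θ)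
        (𝓝 (ConditionedSO.besselDensity n θ))) ∧
    -- the scaled `1`-level density
    (∀ θ : ℝ, 0 < θ →
      Tendsto (fun M : ℕ => Real.pi / M *
          ConditionedSO.kernelDet n M 1 (fun _ => Real.pi * θ / M))
        atTop (𝓝 (ConditionedSO.besselDensity n θ))) ∧
    -- its behaviour near `0`
    (∃ c : ℝ, 0 < c ∧
      Tendsto (fun θ : ℝ => ConditionedSO.besselDensity n θ / θ ^ (2 * n)) (𝓝[>] 0) (𝓝 c)) := by
  exact ⟨ConditionedSO.integral_jacobiP_mul_jacobiP n, ConditionedSO.isLevelDensity_kernelDet n,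
    ConditionedSO.kernelDet_eq_det_mul_prod n, ConditionedSO.christoffel_darboux n,
    fun θ φ hθ hφ h => by
      rw [ConditionedSO.besselKernel_eq_integral n hθ hφ h]
      exact ConditionedSO.tendsto_weightedKernel n θ φ,
    fun θ hθ => by
      refine ⟨?_, ?_, ConditionedSO.tendsto_besselKernel n hθ⟩ <;>
        rw [ConditionedSO.besselDensity_eq_integral n hθ]
      · exact (ConditionedSO.tendsto_weightedKernel n θ θ).1
      · exact (ConditionedSO.tendsto_weightedKernel n θ θ).2,
    fun θ hθ => by
      simp only [ConditionedSO.kernelDet_one]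
      rw [ConditionedSO.besselDensity_eq_integral n hθ]
      exact (ConditionedSO.tendsto_weightedKernel n θ θ).1,
    ConditionedSO.exists_tendsto_besselDensity_div n⟩
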